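/- There are absolute constants $C, K > 0$ such that the following holds. Let $G=(X,Y;E)$ be a finite simple bipartite graph with $|X|=|Y|$ and $E\neq\emptyset$, and let $\varepsilon$ be a real number such that every vertex $v$ satisfies $(1-\varepsilon)|E|/|X| \le \deg(v) \le (1+\varepsilon)|E|/|X|$. For $S\subseteq V=X\cup Y$ let $\mathrm{vol}(S)=\sum_{v\in S}\deg(v)$, and let $$\phi(G)=\min_{S\subseteq V,\; 0<\mathrm{vol}(S)\le \mathrm{vol}(V)/2}\ \frac{|E(S,V\setminus S)|}{\mathrm{vol}(S)}$$ be the conductance of $G$. Assume $\phi(G)^4\ge C\,\varepsilon\ln|X|$. For a matrix $B\in\mathbb{R}_{\ge 0}^{X\times Y}$ write $s(B)$ for the sum of its entries and $r_i(B)$, $c_j(B)$ for its row and column sums; $B$ is called $\eta$-nearly doubly balanced if all $|X|\,r_i(B)$ and $|Y|\,c_j(B)$ lie in $[(1-\eta)s(B),(1+\eta)s(B)]$. Let $s_0>0$ and let $B^{(0)}$ be the $0/1$ biadjacency matrix of $G$ multiplied by $s_0/|E|$, so that $s(B^{(0)})=s_0$ (for $s_0=1$ the input is normalized to size one; for $s_0=|E|$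 it is the biadjacency matrix itself). The gradient flow with input $B^{(0)}$ is $$\frac{d}{dt}a_{ij}=\Big(\big(s(B)-|X|\,r_i(B)\big)+\big(s(B)-|Y|\,c_j(B)\big)\Big)a_{ij},\qquad B^{(t)}_{ij}=\big(a^{(t)}_{ij}\big)^2,\qquad a^{(0)}_{ij}=\sqrt{B^{(0)}_{ij}} .$$ Then the gradient flow exists for all $t\ge 0$, and for every solution, every $0<\eta\le 1$ and every $t\ge 0$ with $$ s_0\,\phi(G)^2\, t\ \ge\ K\,\ln|X|\,\ln(1/\eta) ,$$ the matrix $B^{(t)}$ is a scaling of the biadjacency matrix of $G$ (it equals $L\cdot B\cdot R$ with $B$ that matrix and $L,R$ diagonal with positive diagonal entries), it is $\eta$-nearly doubly balanced, and $\frac{|X|}{s(B^{(t)})}B^{(t)}$ is an $\eta$-nearly perfect fractional matching of $G$, i.e. a non-negative weighting of the edges of $G$ whose sum at every vertex lies in $[1-\eta,1+\eta]$. In particular, for $\phi(G)>0$ and $s_0\ge 1$, the flow reaches an $\eta$-nearly perfect fractional matching in time $O\big(\ln|X|\,\ln(1/\eta)/\phi(G)^2\big)$. -/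

import Mathlib

noncomputable section

namespace MatrixScaling

variable {X Y V : Type*} [Fintype X] [Fintype Y] [Fintype V]

/-- The size `s(B)` of a matrix: the sum of all its entries. -/
def size (B : Matrix X Y ℝ) : ℝ := ∑ i, ∑ j, B i j

/-- The `i`-th row sum `r_i(B)`. -/
def rowSum (B : Matrix X Y ℝ) (i : X) : ℝ := ∑ j, B i j

/-- The `j`-th column sum `c_j(B)`. -/
def colSum (B : Matrix X Y ℝ) (j : Y) : ℝ := ∑ i, B i j

/-- A non-negative `m × n` matrix is `η`-nearly doubly balanced if every row sum lies in
`[(1 - η) s / m, (1 + η) s / m]` and every column sum lies in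
`[(1 - η) s / n, (1 + η) s / n]`. -/
structure IsNearlyDoublyBalanced (η : ℝ) (B : Matrix X Y ℝ) : Prop where
  nonneg : ∀ i j, 0 ≤ B i j
  row_lower : ∀ i, (1 - η) * (size B / Fintype.card X) ≤ rowSum B i
  row_upper : ∀ i, rowSum B i ≤ (1 + η) * (size B / Fintype.card X)
  col_lower : ∀ j, (1 - η) * (size B / Fintype.card Y) ≤ colSum B j
  col_upper : ∀ j, colSum B j ≤ (1 + η) * (size B / Fintype.card Y)

/-- `B'` is a scaling of `B`: it is `L B R` for diagonal matrices `L`, `R` with positive diagonal. -/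
def IsScalingOf (B' B : Matrix X Y ℝ) : Prop :=
  ∃ (l : X → ℝ) (r : Y → ℝ), (∀ i, 0 < l i) ∧ (∀ j, 0 < r j) ∧
    ∀ i j, B' i j = l i * B i j * r j

/-- The entrywise square; `B = (a_ij ^ 2)` is the matrix being scaled when the state of the flow
is `a`. -/
def entrySq (a : Matrix X Y ℝ) : Matrix X Y ℝ := fun i j => a i j ^ 2

/-- The velocity of the flow at the state `a`: with `B = (a_ij ^ 2)`, its `(i, j)` entry is
`((s(B) - m r_i(B)) + (s(B) - n c_j(B))) a_ij`. This is `-1/4` times the gradient in `a` of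
`(1/m) ∑ i, (s(B) - m r_i(B))^2 + (1/n) ∑ j, (s(B) - n c_j(B))^2`. -/
def velocity (a : Matrix X Y ℝ) : Matrix X Y ℝ := fun i j =>
  ((size (entrySq a) - Fintype.card X * rowSum (entrySq a) i) +
    (size (entrySq a) - Fintype.card Y * colSum (entrySq a) j)) * a i j

/-- `a` is the gradient flow (continuous matrix scaling) on `[0, ∞)` with input the
non-negative matrix `B₀`: `a_ij(0) = √(B₀)_ij` and `d/dt a_ij = velocity(a)_ij`. The scaled matrix
at time `t` is `entrySq (a t)`. -/
structure IsGradientFlow (B₀ : Matrix X Y ℝ) (a : ℝ → Matrix X Y ℝ) : Prop where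
  init : ∀ i j, a 0 i j = Real.sqrt (B₀ i j)
  deriv : ∀ t, 0 ≤ t → ∀ i j,
    HasDerivWithinAt (fun τ => a τ i j) (velocity (a t) i j) (Set.Ici 0) t

/-- `vol(S)` in an edge-weighted graph with symmetric non-negative weights `w`. -/
def vol (w : V → V → ℝ) (S : Finset V) : ℝ := ∑ i ∈ S, ∑ j, w i j

/-- The conductance `φ(S)` of a vertex set: weight of the edges leaving `S` over `vol(S)`. -/
def setConductance [DecidableEq V] (w : V → V → ℝ) (S : Finset V) : ℝ :=
  (∑ i ∈ S, ∑ j ∈ Sᶜ, w i j) / vol w S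

/-- The conductance `φ(G)` of an edge-weighted graph: the minimum of `φ(S)` over the vertex sets
`S` with `vol(S) ≤ vol(V) / 2`, where, as always, only sets with `vol(S) ≠ 0` count. -/
def conductance [DecidableEq V] (w : V → V → ℝ) : ℝ :=
  ⨅ S : {S : Finset V // 0 < vol w S ∧ vol w S ≤ vol w Finset.univ / 2}, setConductance w S.1

/-- The `0/1` matrix, with rows `X` and columns `Y`, of a bipartite graph with parts `X`, `Y`. -/
def biadjacency (G : SimpleGraph (X ⊕ Y)) [DecidableRel G.Adj] : Matrix X Y ℝ :=
  fun i j => if G.Adj (Sum.inl i) (Sum.inr j) then 1 else 0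

/-- `x` is an `η`-nearly perfect fractional matching of `G`: non-negative weights on the edges
of `G` whose sum at every vertex is within `η` of `1`. -/
structure IsNearlyPerfectFractionalMatching (G : SimpleGraph (X ⊕ Y)) (η : ℝ)
    (x : Matrix X Y ℝ) : Prop where
  nonneg : ∀ i j, 0 ≤ x i j
  support : ∀ i j, ¬ G.Adj (Sum.inl i) (Sum.inr j) → x i j = 0
  left : ∀ i, |rowSum x i - 1| ≤ η
  right : ∀ j, |colSum x j - 1| ≤ η

end MatrixScaling

end

/-!
Along the flow, the deviations `s - m r_i` and `s - n c_j` have mean zero over the rows and over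
the columns, and their mean square, the imbalance, decays like `exp (-4κt)` as long as the
bipartite graph with edge weights `B` satisfies a Poincaré inequality with constant `κ`. At time
`0`, Cheeger's inequality provides one with `κ` of the order of `s₀ φ²`. It survives as long as the
entries of `B` stay comparable to the initial ones, and as `B_ij` moves by the factor
`exp (2 (p_i + p_j))`, where `p` is the time integral of the deviations, it suffices to bound these
integrals.

The mean square bounds the largest deviation only up to a factor `√N`, `N` the number of rows or
columns. A maximum principle shows that, meanwhile, the largest deviation exceeds its initial value
`δ` by at most the loss of size, and so stays below `2δ`. The decay wins after time of order
`log N / κ`, so the integrals are `O(δ log N / κ)`. This is small when `ε log N` is small compared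
to `φ²`, and the bootstrap closes.

The flow exists for all time since its velocity points into the ball through its state, as
`⟪a, velocity a⟫` is minus the imbalance.
-/

namespace MatrixScaling

lemma posPart_sq_add_negPart_sq (a : ℝ) : a⁺ ^ 2 + a⁻ ^ 2 = a ^ 2 := by
  rcases le_total 0 a with h | h <;> simp [h]

lemma sq_posPart_sub_add_sq_negPart_sub_le (a b : ℝ) :
    (a⁺ - b⁺) ^ 2 + (a⁻ - b⁻) ^ 2 ≤ (a - b) ^ 2 := by
  have ha : a⁺ - a⁻ = a := posPart_sub_negPart a
  have hb : b⁺ - b⁻ = b := posPart_sub_negPart b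
  have hcross : 0 ≤ (a⁺ - b⁺) * (b⁻ - a⁻) := by
    rcases le_total a b with h | h
    · exact mul_nonneg_of_nonpos_of_nonpos (sub_nonpos.2 (posPart_mono h))
        (sub_nonpos.2 (negPart_anti h))
    · exact mul_nonneg (sub_nonneg.2 (posPart_mono h)) (sub_nonneg.2 (negPart_anti h))
  calc (a⁺ - b⁺) ^ 2 + (a⁻ - b⁻) ^ 2
      ≤ (a⁺ - b⁺) ^ 2 + (a⁻ - b⁻) ^ 2 + 2 * ((a⁺ - b⁺) * (b⁻ - a⁻)) := by linarith
    _ = ((a⁺ - a⁻) - (b⁺ - b⁻)) ^ 2 := by ring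
    _ = (a - b) ^ 2 := by rw [ha, hb]

lemma abs_add_smul_indicator_sub {V : Type*} {g : V → ℝ} (hg : 0 ≤ g) {c : ℝ} (hc : 0 ≤ c)
    {S : Finset V} (hS : ∀ x ∉ S, g x = 0) (x y : V) :
    |(g + c • (S : Set V).indicator (1 : V → ℝ)) x -
      (g + c • (S : Set V).indicator (1 : V → ℝ)) y| =
      |g x - g y| + c * |(S : Set V).indicator (1 : V → ℝ) x - (S : Set V).indicator 1 y| := by
  have habs : ∀ z, |g z| = g z ∧ |g z + c| = g z + c := fun z =>
    ⟨abs_of_nonneg (hg z), abs_of_nonneg (add_nonneg (hg z) hc)⟩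
  by_cases hx : x ∈ S <;> by_cases hy : y ∈ S <;> simp [hx, hy, hS, habs, -neg_add_rev]

section Cheeger

open Finset

variable {V : Type*} [Fintype V] {w : V → V → ℝ}

lemma vol_nonneg (hw : ∀ x y, 0 ≤ w x y) (S : Finset V) : 0 ≤ vol w S :=
  sum_nonneg fun x _ => sum_nonneg fun y _ => hw x y

lemma vol_mono (hw : ∀ x y, 0 ≤ w x y) {S T : Finset V} (h : S ⊆ T) : vol w S ≤ vol w T :=
  sum_le_sum_of_subset_of_nonneg h fun x _ _ => sum_nonneg fun y _ => hw x y

lemma vol_smul (c : ℝ) (w : V → V → ℝ) (S : Finset V) : vol (c • w) S = c * vol w S := by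
  simp only [vol, Pi.smul_apply, smul_eq_mul, mul_sum]

lemma exists_median (hw : ∀ x y, 0 ≤ w x y) (f : V → ℝ) :
    ∃ m, vol w {x | m < f x} ≤ vol w univ / 2 ∧ vol w {x | f x < m} ≤ vol w univ / 2 := by
  have h0 := vol_nonneg hw univ
  rcases isEmpty_or_nonempty V with hV | hV
  · exact ⟨0, by simp [vol], by simp [vol]⟩
  have hne : ({x | vol w {y | f x < f y} ≤ vol w univ / 2} : Finset V).Nonempty := by
    obtain ⟨x, hx⟩ := Finite.exists_max f
    refine ⟨x, mem_filter.2 ⟨mem_univ x, ?_⟩⟩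
    rw [filter_false_of_mem fun y _ => (hx y).not_gt, vol, sum_empty]
    positivity
  obtain ⟨x, hx, hmin⟩ := exists_min_image _ f hne
  refine ⟨f x, (mem_filter.1 hx).2, ?_⟩
  by_contra! hlt
  have hbelow : ({y | f y < f x} : Finset V).Nonempty :=
    nonempty_of_sum_ne_zero (f := fun y => ∑ z, w y z) (by unfold vol at *; linarith)
  obtain ⟨z, hz, hmax⟩ := exists_max_image _ f hbelow
  have hzx : f z < f x := (mem_filter.1 hz).2
  have hsplit : vol w {y | f z < f y} + vol w {y | ¬ f z < f y} = vol w univ :=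
    sum_filter_add_sum_filter_not univ (fun y => f z < f y) _
  have hsub : vol w {y | f y < f x} ≤ vol w {y | ¬ f z < f y} :=
    vol_mono hw fun y hy => mem_filter.2 ⟨mem_univ y, (hmax y hy).not_gt⟩
  exact (hmin z (mem_filter.2 ⟨mem_univ z, by linarith⟩)).not_gt hzx

@[elab_as_elim]
lemma nonneg_function_induction {V : Type*} [Finite V] {P : (V → ℝ) → Prop} (zero : P 0)
    (add_indicator : ∀ (g : V → ℝ) (c : ℝ) (S : Finset V), 0 ≤ g → 0 < c → (∀ x ∉ S, g x = 0) →
      P g → P (g + c • (S : Set V).indicator 1)) {h : V → ℝ} (h0 : 0 ≤ h) : P h := by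
  classical
  have := Fintype.ofFinite V
  induction hn : #{x | h x ≠ 0} using Nat.strong_induction_on generalizing h with
  | _ n ih =>
  set S : Finset V := {x | h x ≠ 0} with hS
  have hoff : ∀ x ∉ S, h x = 0 := fun x hx => by simpa [hS] using hx
  rcases S.eq_empty_or_nonempty with hempty | hne
  · rwa [show h = 0 from funext fun x => hoff x (by simp [hempty])]
  obtain ⟨x₀, hx₀, hmin⟩ := S.exists_min_image h hne
  set g : V → ℝ := h - h x₀ • (S : Set V).indicator 1 with hg
  have hgS : ∀ x ∈ S, g x = h x - h x₀ := fun x hx => by simp [hg, hx]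
  have hgoff : ∀ x ∉ S, g x = 0 := fun x hx => by simp [hg, hx, hoff x hx]
  have hg0 : 0 ≤ g := fun x => by
    by_cases hx : x ∈ S
    · rw [hgS x hx]; exact sub_nonneg.2 (hmin x hx)
    · exact (hgoff x hx).ge
  have hsub : ({x | g x ≠ 0} : Finset V) ⊂ S := by
    refine (ssubset_iff_of_subset fun x hx => ?_).2 ⟨x₀, hx₀, by simp [hgS x₀ hx₀]⟩
    exact not_imp_comm.1 (hgoff x) (mem_filter.1 hx).2
  have hpos : 0 < h x₀ := (h0 x₀).lt_of_ne' (mem_filter.1 hx₀).2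
  simpa [hg] using add_indicator g (h x₀) S hg0 hpos hgoff (ih _ (hn ▸ card_lt_card hsub) hg0 rfl)

lemma sum_mul_sq_le_sum_mul_sub_sq {π : V → ℝ} (hπ : ∀ x, 0 ≤ π x) {f : V → ℝ}
    (hf : ∑ x, π x * f x = 0) (m : ℝ) :
    ∑ x, π x * f x ^ 2 ≤ ∑ x, π x * (f x - m) ^ 2 := by
  have hexpand : ∑ x, π x * (f x - m) ^ 2 =
      ∑ x, π x * f x ^ 2 - 2 * m * ∑ x, π x * f x + m ^ 2 * ∑ x, π x := by
    simp only [mul_sum, ← sum_sub_distrib, ← sum_add_distrib]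
    exact sum_congr rfl fun x _ => by ring
  have := mul_nonneg (sq_nonneg m) (sum_nonneg fun x (_ : x ∈ univ) => hπ x)
  rw [hexpand, hf]
  linarith

lemma sum_mul_sq_add_le (hw : ∀ x y, 0 ≤ w x y) (hs : ∀ x y, w x y = w y x) (g : V → ℝ) :
    ∑ x, ∑ y, w x y * (g x + g y) ^ 2 ≤ 4 * ∑ x, (∑ y, w x y) * g x ^ 2 := by
  have hleft : ∑ x, ∑ y, w x y * g x ^ 2 = ∑ x, (∑ y, w x y) * g x ^ 2 := by
    simp only [sum_mul]
  have hright : ∑ x, ∑ y, w x y * g y ^ 2 = ∑ x, (∑ y, w x y) * g x ^ 2 := by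
    rw [sum_comm, ← hleft]
    simp only [hs]
  calc ∑ x, ∑ y, w x y * (g x + g y) ^ 2
      ≤ ∑ x, ∑ y, (2 * (w x y * g x ^ 2) + 2 * (w x y * g y ^ 2)) := by
        gcongr with x _ y _
        linarith [mul_le_mul_of_nonneg_left (add_sq_le (a := g x) (b := g y)) (hw x y)]
    _ = 4 * ∑ x, (∑ y, w x y) * g x ^ 2 := by
        simp only [sum_add_distrib, ← mul_sum, hleft, hright]; ring

lemma sq_sum_mul_abs_sq_sub_sq_le (hw : ∀ x y, 0 ≤ w x y) (g : V → ℝ) :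
    (∑ x, ∑ y, w x y * |g x ^ 2 - g y ^ 2|) ^ 2 ≤
      (∑ x, ∑ y, w x y * (g x - g y) ^ 2) * ∑ x, ∑ y, w x y * (g x + g y) ^ 2 := by
  simp only [← Fintype.sum_prod_type']
  refine sum_sq_le_sum_mul_sum_of_sq_le_mul _ (fun p _ => mul_nonneg (hw _ _) (sq_nonneg _))
    (fun p _ => mul_nonneg (hw _ _) (sq_nonneg _)) fun p _ => le_of_eq ?_
  rw [mul_pow, sq_abs]
  ring

variable [DecidableEq V]

lemma setConductance_nonneg (hw : ∀ x y, 0 ≤ w x y) (S : Finset V) : 0 ≤ setConductance w S :=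
  div_nonneg (sum_nonneg fun x _ => sum_nonneg fun y _ => hw x y) (vol_nonneg hw S)

lemma setConductance_le_one (hw : ∀ x y, 0 ≤ w x y) (S : Finset V) : setConductance w S ≤ 1 :=
  div_le_one_of_le₀ (sum_le_sum fun x _ =>
    sum_le_sum_of_subset_of_nonneg (subset_univ _) fun y _ _ => hw x y) (vol_nonneg hw S)

lemma conductance_nonneg (hw : ∀ x y, 0 ≤ w x y) : 0 ≤ conductance w :=
  Real.iInf_nonneg fun S => setConductance_nonneg hw S.1

lemma conductance_le_setConductance {S : Finset V} (h0 : 0 < vol w S)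
    (h : vol w S ≤ vol w univ / 2) : conductance w ≤ setConductance w S :=
  ciInf_le (f := fun S : {S : Finset V // 0 < vol w S ∧ vol w S ≤ vol w univ / 2} =>
    setConductance w S.1) (Finite.bddBelow_range _) ⟨S, h0, h⟩

lemma conductance_le_one (hw : ∀ x y, 0 ≤ w x y) : conductance w ≤ 1 := by
  rcases isEmpty_or_nonempty {S : Finset V // 0 < vol w S ∧ vol w S ≤ vol w univ / 2} with h | ⟨⟨S⟩⟩
  · rw [conductance, Real.iInf_of_isEmpty]
    exact zero_le_one
  · exact (conductance_le_setConductance S.2.1 S.2.2).trans (setConductance_le_one hw _)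

lemma setConductance_smul {c : ℝ} (hc : c ≠ 0) (w : V → V → ℝ) (S : Finset V) :
    setConductance (c • w) S = setConductance w S := by
  simp only [setConductance, vol_smul, Pi.smul_apply, smul_eq_mul, ← mul_sum]
  exact mul_div_mul_left _ _ hc

lemma conductance_smul {c : ℝ} (hc : 0 < c) (w : V → V → ℝ) :
    conductance (c • w) = conductance w := by
  refine Equiv.iInf_congr (Equiv.subtypeEquivRight fun S => ?_) fun S =>
    (setConductance_smul hc.ne' w S.1).symm
  rw [vol_smul, vol_smul, mul_div_assoc, mul_le_mul_iff_right₀ hc, mul_pos_iff_of_pos_left hc]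

lemma conductance_mul_vol_le (hw : ∀ x y, 0 ≤ w x y) {S : Finset V}
    (h : vol w S ≤ vol w univ / 2) :
    conductance w * vol w S ≤ ∑ x ∈ S, ∑ y ∈ Sᶜ, w x y := by
  rcases (vol_nonneg hw S).eq_or_lt with h0 | h0
  · rw [← h0, mul_zero]
    exact sum_nonneg fun x _ => sum_nonneg fun y _ => hw x y
  · exact (le_div_iff₀ h0).1 (conductance_le_setConductance h0 h)

lemma sum_mul_abs_indicator_sub (hs : ∀ x y, w x y = w y x) (S : Finset V) :
    ∑ x, ∑ y, w x y * |(S : Set V).indicator 1 x - (S : Set V).indicator 1 y| =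
      2 * ∑ x ∈ S, ∑ y ∈ Sᶜ, w x y := by
  have hin : ∀ x ∈ S, ∑ y, w x y * |(S : Set V).indicator 1 x - (S : Set V).indicator 1 y| =
      ∑ y ∈ Sᶜ, w x y := fun x hx => by
    rw [← sum_compl_add_sum S, sum_eq_zero (s := S) fun y hy => by simp [hx, hy], add_zero]
    exact sum_congr rfl fun y hy => by simp [hx, mem_compl.1 hy]
  have hout : ∀ x ∈ Sᶜ, ∑ y, w x y * |(S : Set V).indicator 1 x - (S : Set V).indicator 1 y| =
      ∑ y ∈ S, w x y := fun x hx => by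
    rw [← sum_add_sum_compl S, sum_eq_zero (s := Sᶜ) fun y hy => by
      simp [mem_compl.1 hx, mem_compl.1 hy], add_zero]
    exact sum_congr rfl fun y hy => by simp [mem_compl.1 hx, hy]
  rw [← sum_add_sum_compl S, sum_congr rfl hin, sum_congr rfl hout, two_mul, sum_comm (s := Sᶜ)]
  simp only [hs]

lemma conductance_mul_sum_le (hw : ∀ x y, 0 ≤ w x y) (hs : ∀ x y, w x y = w y x) {U : Finset V}
    (hU : vol w U ≤ vol w univ / 2) {h : V → ℝ} (h0 : 0 ≤ h) (hoff : ∀ x ∉ U, h x = 0) :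
    2 * (conductance w * ∑ x, (∑ y, w x y) * h x) ≤ ∑ x, ∑ y, w x y * |h x - h y| := by
  -- Both sides are additive over the layers of `h`, so it is enough to compare them on one layer.
  revert hoff
  refine nonneg_function_induction (by simp) (fun g c S hg0 hc hgoff ih hoff => ?_) h0
  have hSU : S ⊆ U := fun x hx => by
    by_contra hxU
    have : 0 ≤ g x := hg0 x
    have : g x + c = 0 := by simpa [hx] using hoff x hxU
    linarith
  have hlayer := conductance_mul_vol_le hw ((vol_mono hw hSU).trans hU)
  have hmass : ∑ x, (∑ y, w x y) * (g + c • (S : Set V).indicator (1 : V → ℝ)) x =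
      ∑ x, (∑ y, w x y) * g x + c * vol w S := by
    simp [vol, mul_add, sum_add_distrib, Set.indicator_apply, mul_sum, mul_comm]
  simp only [abs_add_smul_indicator_sub hg0 hc.le hgoff, mul_add, sum_add_distrib,
    mul_left_comm (w _ _), ← mul_sum, sum_mul_abs_indicator_sub hs, hmass]
  have := ih fun x hx => hgoff x fun hxS => hx (hSU hxS)
  have := mul_le_mul_of_nonneg_left hlayer hc.le
  linarith

lemma conductance_sq_mul_sum_sq_le_of_support (hw : ∀ x y, 0 ≤ w x y) (hs : ∀ x y, w x y = w y x)
    {U : Finset V} (hU : vol w U ≤ vol w univ / 2) {g : V → ℝ} (hoff : ∀ x ∉ U, g x = 0) :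
    conductance w ^ 2 * ∑ x, (∑ y, w x y) * g x ^ 2 ≤ ∑ x, ∑ y, w x y * (g x - g y) ^ 2 := by
  have hcoarea := conductance_mul_sum_le hw hs hU (h := fun x => g x ^ 2) (fun x => sq_nonneg _)
    fun x hx => by simp [hoff x hx]
  have hadd := sum_mul_sq_add_le hw hs g
  have hcauchy := sq_sum_mul_abs_sq_sub_sq_le hw g
  set A := ∑ x, (∑ y, w x y) * g x ^ 2
  set D := ∑ x, ∑ y, w x y * (g x - g y) ^ 2
  have hD : 0 ≤ D := sum_nonneg fun x _ => sum_nonneg fun y _ => mul_nonneg (hw x y) (sq_nonneg _)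
  have hA : 0 ≤ A := sum_nonneg fun x _ => mul_nonneg (sum_nonneg fun y _ => hw x y) (sq_nonneg _)
  rcases hA.eq_or_lt with hzero | hpos
  · rwa [← hzero, mul_zero]
  have hφ := conductance_nonneg hw
  refine le_of_mul_le_mul_right ?_ (show 0 < 4 * A by positivity)
  calc conductance w ^ 2 * A * (4 * A) = (2 * (conductance w * A)) ^ 2 := by ring
    _ ≤ (∑ x, ∑ y, w x y * |g x ^ 2 - g y ^ 2|) ^ 2 := by gcongr
    _ ≤ D * ∑ x, ∑ y, w x y * (g x + g y) ^ 2 := hcauchy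
    _ ≤ D * (4 * A) := by gcongr

theorem exists_conductance_sq_mul_sum_sq_le (hw : ∀ x y, 0 ≤ w x y) (hs : ∀ x y, w x y = w y x)
    (f : V → ℝ) : ∃ m, conductance w ^ 2 * ∑ x, (∑ y, w x y) * (f x - m) ^ 2 ≤
      ∑ x, ∑ y, w x y * (f x - f y) ^ 2 := by
  obtain ⟨m, habove, hbelow⟩ := exists_median hw f
  have hpos := conductance_sq_mul_sum_sq_le_of_support hw hs habove (g := fun x => (f x - m)⁺)
    fun x hx => by simpa [sub_nonpos] using hx
  have hneg := conductance_sq_mul_sum_sq_le_of_support hw hs hbelow (g := fun x => (f x - m)⁻)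
    fun x hx => by simpa [sub_nonneg] using hx
  refine ⟨m, ?_⟩
  calc conductance w ^ 2 * ∑ x, (∑ y, w x y) * (f x - m) ^ 2
      = conductance w ^ 2 * ∑ x, (∑ y, w x y) * (f x - m)⁺ ^ 2 +
          conductance w ^ 2 * ∑ x, (∑ y, w x y) * (f x - m)⁻ ^ 2 := by
        simp only [← mul_add, ← sum_add_distrib, posPart_sq_add_negPart_sq]
    _ ≤ ∑ x, ∑ y, w x y * ((f x - m)⁺ - (f y - m)⁺) ^ 2 +
          ∑ x, ∑ y, w x y * ((f x - m)⁻ - (f y - m)⁻) ^ 2 := add_le_add hpos hneg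
    _ = ∑ x, ∑ y, w x y * (((f x - m)⁺ - (f y - m)⁺) ^ 2 + ((f x - m)⁻ - (f y - m)⁻) ^ 2) := by
        simp only [← sum_add_distrib, mul_add]
    _ ≤ ∑ x, ∑ y, w x y * (f x - f y) ^ 2 := by
        gcongr with x _ y _
        · exact hw x y
        · simpa using sq_posPart_sub_add_sq_negPart_sub_le (f x - m) (f y - m)

theorem conductance_sq_mul_sum_sq_le (hw : ∀ x y, 0 ≤ w x y) (hs : ∀ x y, w x y = w y x)
    {π : V → ℝ} (hπ : ∀ x, 0 ≤ π x) (hπw : ∀ x, π x ≤ ∑ y, w x y) {f : V → ℝ}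
    (hf : ∑ x, π x * f x = 0) :
    conductance w ^ 2 * ∑ x, π x * f x ^ 2 ≤ ∑ x, ∑ y, w x y * (f x - f y) ^ 2 := by
  obtain ⟨m, hm⟩ := exists_conductance_sq_mul_sum_sq_le hw hs f
  refine (mul_le_mul_of_nonneg_left ?_ (sq_nonneg _)).trans hm
  calc ∑ x, π x * f x ^ 2 ≤ ∑ x, π x * (f x - m) ^ 2 :=
        sum_mul_sq_le_sum_mul_sub_sq hπ hf m
    _ ≤ ∑ x, (∑ y, w x y) * (f x - m) ^ 2 := by
        gcongr with x _
        exact hπw x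

end Cheeger

section Calculus

open Set Filter Topology

lemma le_of_hasDerivWithinAt_le {f f' g g' : ℝ → ℝ} {T : ℝ}
    (hf : ∀ t ∈ Icc 0 T, HasDerivWithinAt f (f' t) (Ici 0) t)
    (hg : ∀ t ∈ Icc 0 T, HasDerivWithinAt g (g' t) (Ici 0) t)
    (h0 : f 0 ≤ g 0) (h : ∀ t ∈ Icc 0 T, f' t ≤ g' t) (hT : 0 ≤ T) : f T ≤ g T :=
  image_le_of_deriv_right_le_deriv_boundary
    (fun t ht => (hf t ht).continuousWithinAt.mono Icc_subset_Ici_self)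
    (fun t ht => (hf t (Ico_subset_Icc_self ht)).mono (Ici_subset_Ici.2 ht.1)) h0
    (fun t ht => (hg t ht).continuousWithinAt.mono Icc_subset_Ici_self)
    (fun t ht => (hg t (Ico_subset_Icc_self ht)).mono (Ici_subset_Ici.2 ht.1))
    (fun t ht => h t (Ico_subset_Icc_self ht)) (right_mem_Icc.2 hT)

lemma le_mul_exp_of_hasDerivWithinAt_le {f f' : ℝ → ℝ} {c T : ℝ}
    (hf : ∀ t ∈ Icc 0 T, HasDerivWithinAt f (f' t) (Ici 0) t)
    (h : ∀ t ∈ Icc 0 T, f' t ≤ -(c * f t)) (hT : 0 ≤ T) : f T ≤ f 0 * Real.exp (-(c * T)) := by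
  have hexp : ∀ t, HasDerivWithinAt (fun t => Real.exp (c * t)) (Real.exp (c * t) * c) (Ici 0) t :=
    fun t => (((hasDerivAt_id t).const_mul c).exp.congr_deriv (by simp)).hasDerivWithinAt
  have hconst : f T * Real.exp (c * T) ≤ f 0 := by
    refine le_of_hasDerivWithinAt_le (fun t ht => (hf t ht).mul (hexp t))
      (fun t _ => hasDerivWithinAt_const t _ (f 0)) (by simp) (fun t ht => ?_) hT
    nlinarith [mul_le_mul_of_nonneg_right (h t ht) (Real.exp_nonneg (c * t))]
  rwa [Real.exp_neg, ← div_eq_mul_inv, le_div_iff₀ (Real.exp_pos _)]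

lemma norm_le_div_of_norm_deriv_le_mul_exp {E : Type*} [NormedAddCommGroup E] [NormedSpace ℝ E]
    {p p' : ℝ → E} {A c T : ℝ} (hA : 0 ≤ A) (hc : 0 < c) (hp0 : p 0 = 0)
    (hp : ∀ t ∈ Icc 0 T, HasDerivWithinAt p (p' t) (Ici 0) t)
    (hp' : ∀ t ∈ Icc 0 T, ‖p' t‖ ≤ A * Real.exp (-(c * t))) (hT : 0 ≤ T) : ‖p T‖ ≤ A / c := by
  have hbound : ∀ t, HasDerivAt (fun t => A / c * (1 - Real.exp (-(c * t))))
      (A * Real.exp (-(c * t))) t := fun t =>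
    ((((hasDerivAt_id t).const_mul c).neg.exp.const_sub 1).const_mul (A / c)).congr_deriv (by
      simp only [Pi.neg_apply, id_eq]
      field_simp)
  refine (image_norm_le_of_norm_deriv_right_le_deriv_boundary
    (fun t ht => (hp t ht).continuousWithinAt.mono Icc_subset_Ici_self)
    (fun t ht => (hp t (Ico_subset_Icc_self ht)).mono (Ici_subset_Ici.2 ht.1)) (by simp [hp0])
    hbound (fun t ht => hp' t (Ico_subset_Icc_self ht)) (right_mem_Icc.2 hT)).trans ?_
  exact mul_le_of_le_one_right (by positivity) (sub_le_self _ (Real.exp_nonneg _))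

/- `⨆ k, f k` has non-positive right slopes, as only the maximal `f k` matter for small times. -/
lemma forall_le_of_hasDerivWithinAt_nonpos_of_isMax {ι : Type*} [Finite ι] {f f' : ι → ℝ → ℝ}
    (hf : ∀ k t, 0 ≤ t → HasDerivWithinAt (f k) (f' k t) (Ici 0) t)
    (hmax : ∀ k t, 0 ≤ t → (∀ l, f l t ≤ f k t) → f' k t ≤ 0) {M : ℝ} (h0 : ∀ k, f k 0 ≤ M)
    {t : ℝ} (ht : 0 ≤ t) (k : ι) : f k t ≤ M := by
  cases nonempty_fintype ι
  have hne : (Finset.univ : Finset ι).Nonempty := ⟨k, Finset.mem_univ k⟩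
  set F : ℝ → ℝ := fun τ => Finset.univ.sup' hne fun l => f l τ
  have hF : ContinuousOn F (Icc 0 t) := ContinuousOn.finset_sup'_apply hne fun l _ τ hτ =>
    (hf l τ hτ.1).continuousWithinAt.mono Icc_subset_Ici_self
  have hslope : ∀ τ ∈ Ico 0 t, ∀ r, 0 < r → ∃ᶠ z in 𝓝[>] τ, slope F τ z < r := by
    refine fun τ hτ r hr => Eventually.frequently ?_
    have hall : ∀ l, ∀ᶠ z in 𝓝[>] τ, f l z < F τ + r * (z - τ) := fun l => by
      have hder : HasDerivWithinAt (f l) (f' l τ) (Ioi τ) τ :=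
        (hf l τ hτ.1).mono (Ioi_subset_Ici hτ.1)
      have hle : f l τ ≤ F τ := Finset.le_sup' (fun l => f l τ) (Finset.mem_univ l)
      by_cases hl : ∀ l', f l' τ ≤ f l τ
      · have hlt := hder.limsup_slope_le' (notMem_Ioi.2 le_rfl) ((hmax l τ hτ.1 hl).trans_lt hr)
        filter_upwards [hlt, self_mem_nhdsWithin] with z hz (hτz : τ < z)
        rw [slope_def_field, div_lt_iff₀ (sub_pos.2 hτz)] at hz
        linarith
      · obtain ⟨l', hl'⟩ := not_forall.1 hl
        have hlt : f l τ < F τ := (not_le.1 hl').trans_le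
          (Finset.le_sup' (fun l => f l τ) (Finset.mem_univ l'))
        filter_upwards [hder.continuousWithinAt.eventually_lt_const hlt, self_mem_nhdsWithin]
          with z hz (hτz : τ < z)
        nlinarith [sub_pos.2 hτz]
    filter_upwards [eventually_all.2 hall, self_mem_nhdsWithin] with z hz (hτz : τ < z)
    rw [slope_def_field, div_lt_iff₀ (sub_pos.2 hτz), sub_lt_iff_lt_add']
    exact (Finset.sup'_lt_iff hne).2 fun l _ => hz l
  have hFt : F t ≤ M := image_le_of_liminf_slope_right_le_deriv_boundary hF
    (B := fun _ => M) (Finset.sup'_le hne _ fun l _ => h0 l) continuousOn_const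
    (fun τ _ => hasDerivWithinAt_const τ _ M) hslope (right_mem_Icc.2 ht)
  exact (Finset.le_sup' (fun l => f l t) (Finset.mem_univ k)).trans hFt

lemma exists_hasDerivWithinAt_Ici {E : Type*} [NormedAddCommGroup E] [NormedSpace ℝ E]
    [CompleteSpace E] {f : ℝ → E} (hf : ContinuousOn f (Ici 0)) :
    ∃ F : ℝ → E, F 0 = 0 ∧ ∀ t, 0 ≤ t → HasDerivWithinAt F (f t) (Ici 0) t := by
  have hcont : Continuous fun t => f (max t 0) :=
    hf.comp_continuous (by fun_prop) fun t => mem_Ici.2 (le_max_right _ _)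
  refine ⟨fun t => ∫ τ in (0 : ℝ)..t, f (max τ 0), by simp, fun t ht => ?_⟩
  have := (hcont.integral_hasStrictDerivAt 0 t).hasDerivAt.hasDerivWithinAt (s := Ici 0)
  rwa [max_eq_left ht] at this

lemma forall_lt_of_bootstrap {f : ℝ → ℝ} {a : ℝ} (hf : ContinuousOn f (Ici 0)) (h0 : f 0 ≤ a)
    (h : ∀ T, 0 ≤ T → (∀ t ∈ Icc 0 T, f t ≤ a) → f T < a) {T : ℝ} (hT : 0 ≤ T) : f T < a := by
  by_contra! hbad
  have hclosed : IsClosed (Icc 0 T ∩ f ⁻¹' Ici a) :=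
    (hf.mono Icc_subset_Ici_self).preimage_isClosed_of_isClosed isClosed_Icc isClosed_Ici
  obtain ⟨t₀, ⟨ht₀, hat₀⟩, hleast⟩ := (isCompact_Icc.of_isClosed_subset hclosed
    inter_subset_left).exists_isLeast ⟨T, right_mem_Icc.2 hT, hbad⟩
  obtain ⟨τ, hτ, hfτ⟩ := intermediate_value_Icc ht₀.1 (hf.mono Icc_subset_Ici_self) ⟨h0, hat₀⟩
  have hτ₀ : τ = t₀ := le_antisymm hτ.2 (hleast ⟨⟨hτ.1, hτ.2.trans ht₀.2⟩, hfτ.ge⟩)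
  have hgood : ∀ t ∈ Icc 0 t₀, f t ≤ a := fun t ht => by
    by_contra! hlt
    have : t₀ ≤ t := hleast ⟨⟨ht.1, ht.2.trans ht₀.2⟩, hlt.le⟩
    rw [le_antisymm ht.2 this, ← hτ₀, hfτ] at hlt
    exact lt_irrefl a hlt
  exact (h t₀ ht₀.1 hgood).not_ge hat₀

/- The second bound is too large by a factor `√N` at first; where it beats the first one,
`y ≥ log N + 1`, and part of the exponent pays for that factor. -/
lemma abs_le_mul_exp_of_sq_le {x A N y : ℝ} (hN : 1 ≤ N) (hA : |x| ≤ A)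
    (hx : x ^ 2 ≤ N * (A * Real.exp (-y)) ^ 2) :
    |x| ≤ A * Real.exp (1 - y / (Real.log N + 1)) := by
  have hA0 : 0 ≤ A := (abs_nonneg x).trans hA
  have hlog : 0 ≤ Real.log N := Real.log_nonneg hN
  have hL : 0 < Real.log N + 1 := by linarith
  rcases le_total y (Real.log N + 1) with hy | hy
  · exact hA.trans (le_mul_of_one_le_right hA0
      (Real.one_le_exp (sub_nonneg.2 ((div_le_one hL).2 hy))))
  · refine abs_le_of_sq_le_sq (hx.trans ?_) (by positivity)
    have hz : 1 ≤ y / (Real.log N + 1) := (one_le_div hL).2 hy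
    have hexponent : Real.log N + 2 * -y ≤ 2 * (1 - y / (Real.log N + 1)) := by
      have := div_mul_cancel₀ y hL.ne'
      nlinarith [mul_le_mul_of_nonneg_right hz hlog]
    calc N * (A * Real.exp (-y)) ^ 2 = A ^ 2 * Real.exp (Real.log N + 2 * -y) := by
          rw [Real.exp_add, Real.exp_log (by linarith), two_mul, Real.exp_add]; ring
      _ ≤ A ^ 2 * Real.exp (2 * (1 - y / (Real.log N + 1))) := by gcongr
      _ = (A * Real.exp (1 - y / (Real.log N + 1))) ^ 2 := by
          rw [two_mul, Real.exp_add]; ring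

end Calculus

open Finset

variable {X Y : Type*} [Fintype X] [Fintype Y]

section Defect

/-- The deviations `s(B) - m r_i(B)` and `s(B) - n c_j(B)` of the rows and columns from being
doubly balanced, as one vector, whose sup norm `‖defect B‖` measures the balance of `B`. -/
def defect (B : Matrix X Y ℝ) : X ⊕ Y → ℝ :=
  Sum.elim (fun i => size B - Fintype.card X * rowSum B i)
    fun j => size B - Fintype.card Y * colSum B j

/-- The potential `(1/m) ∑ (s - m r_i)² + (1/n) ∑ (s - n c_j)²` which the gradient flow
decreases. -/
noncomputable def imbalance (B : Matrix X Y ℝ) : ℝ :=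
  (∑ i, defect B (.inl i) ^ 2) / Fintype.card X + (∑ j, defect B (.inr j) ^ 2) / Fintype.card Y

lemma defect_inl (B : Matrix X Y ℝ) (i : X) :
    defect B (.inl i) = size B - Fintype.card X * rowSum B i := rfl

lemma defect_inr (B : Matrix X Y ℝ) (j : Y) :
    defect B (.inr j) = size B - Fintype.card Y * colSum B j := rfl

lemma sum_rowSum (B : Matrix X Y ℝ) : ∑ i, rowSum B i = size B := rfl

lemma sum_colSum (B : Matrix X Y ℝ) : ∑ j, colSum B j = size B := sum_comm

lemma sum_defect_inl (B : Matrix X Y ℝ) : ∑ i, defect B (.inl i) = 0 := by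
  simp [defect_inl, ← mul_sum, sum_rowSum]

lemma sum_defect_inr (B : Matrix X Y ℝ) : ∑ j, defect B (.inr j) = 0 := by
  simp [defect_inr, ← mul_sum, sum_colSum]

lemma imbalance_nonneg (B : Matrix X Y ℝ) : 0 ≤ imbalance B := by
  unfold imbalance
  positivity

lemma sum_mul_defect_inl_div (M : Matrix X Y ℝ) {p : X → ℝ} (hp : ∑ i, p i = 0) :
    (∑ i, p i * defect M (.inl i)) / Fintype.card X = -∑ i, ∑ j, p i * M i j := by
  have hsum : ∑ i, p i * defect M (.inl i) = Fintype.card X * -∑ i, ∑ j, p i * M i j := by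
    simp only [defect_inl, mul_sub, sum_sub_distrib, ← sum_mul, hp, mul_left_comm (p _), ← mul_sum]
    simp [rowSum]
  rw [hsum]
  refine mul_div_cancel_left_of_imp fun h => ?_
  have := Fintype.card_eq_zero_iff.1 (Nat.cast_eq_zero.1 h)
  simp

lemma sum_mul_defect_inr_div (M : Matrix X Y ℝ) {q : Y → ℝ} (hq : ∑ j, q j = 0) :
    (∑ j, q j * defect M (.inr j)) / Fintype.card Y = -∑ i, ∑ j, q j * M i j := by
  have hsum : ∑ j, q j * defect M (.inr j) = Fintype.card Y * -∑ i, ∑ j, q j * M i j := by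
    simp only [defect_inr, mul_sub, sum_sub_distrib, ← sum_mul, hq, mul_left_comm (q _), ← mul_sum]
    rw [sum_comm (s := (univ : Finset X))]
    simp [colSum, mul_sum]
  rw [hsum]
  refine mul_div_cancel_left_of_imp fun h => ?_
  have := Fintype.card_eq_zero_iff.1 (Nat.cast_eq_zero.1 h)
  simp

lemma sum_defect_mul_defect (B M : Matrix X Y ℝ) :
    (∑ i, defect B (.inl i) * defect M (.inl i)) / Fintype.card X +
        (∑ j, defect B (.inr j) * defect M (.inr j)) / Fintype.card Y =
      -∑ i, ∑ j, (defect B (.inl i) + defect B (.inr j)) * M i j := by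
  rw [sum_mul_defect_inl_div M (sum_defect_inl B), sum_mul_defect_inr_div M (sum_defect_inr B)]
  simp only [add_mul, sum_add_distrib, neg_add]

lemma sum_defect_add_defect_mul (B : Matrix X Y ℝ) :
    ∑ i, ∑ j, (defect B (.inl i) + defect B (.inr j)) * B i j = -imbalance B := by
  rw [← neg_eq_iff_eq_neg, ← sum_defect_mul_defect]
  simp only [imbalance, sq]

lemma imbalance_le (B : Matrix X Y ℝ) : imbalance B ≤ 2 * ‖defect B‖ ^ 2 := by
  have hk : ∀ k, defect B k ^ 2 ≤ ‖defect B‖ ^ 2 := fun k =>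
    sq_le_sq.2 ((norm_le_pi_norm (defect B) k).trans (le_abs_self _))
  rw [imbalance, two_mul]
  gcongr <;> refine div_le_of_le_mul₀ (Nat.cast_nonneg _) (sq_nonneg _) ?_ <;>
    simpa [mul_comm] using sum_le_card_nsmul univ _ _ fun k _ => hk _

lemma norm_defect_sq_le {N : ℝ} (hX : Fintype.card X ≤ N) (hY : Fintype.card Y ≤ N)
    (B : Matrix X Y ℝ) : ‖defect B‖ ^ 2 ≤ N * imbalance B := by
  have hΔ := imbalance_nonneg B
  have hN : 0 ≤ N := (Nat.cast_nonneg _).trans hX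
  suffices h : ∀ k, defect B k ^ 2 ≤ N * imbalance B by
    rw [← Real.le_sqrt (norm_nonneg _) (by positivity)]
    exact (pi_norm_le_iff_of_nonneg (Real.sqrt_nonneg _)).2 fun k => Real.abs_le_sqrt (h k)
  rintro (i | j)
  · have hm : (0 : ℝ) < Fintype.card X := Nat.cast_pos.2 (Fintype.card_pos_iff.2 ⟨i⟩)
    calc defect B (.inl i) ^ 2 ≤ ∑ i, defect B (.inl i) ^ 2 :=
          single_le_sum (f := fun i => defect B (.inl i) ^ 2) (fun _ _ => sq_nonneg _) (mem_univ i)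
      _ = Fintype.card X * ((∑ i, defect B (.inl i) ^ 2) / Fintype.card X) := by field_simp
      _ ≤ N * imbalance B := by
          gcongr
          exact le_add_of_nonneg_right (by positivity)
  · have hn : (0 : ℝ) < Fintype.card Y := Nat.cast_pos.2 (Fintype.card_pos_iff.2 ⟨j⟩)
    calc defect B (.inr j) ^ 2 ≤ ∑ j, defect B (.inr j) ^ 2 :=
          single_le_sum (f := fun j => defect B (.inr j) ^ 2) (fun _ _ => sq_nonneg _) (mem_univ j)
      _ = Fintype.card Y * ((∑ j, defect B (.inr j) ^ 2) / Fintype.card Y) := by field_simp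
      _ ≤ N * imbalance B := by
          gcongr
          exact le_add_of_nonneg_left (by positivity)

lemma isNearlyDoublyBalanced_iff [Nonempty X] [Nonempty Y] {η : ℝ} {B : Matrix X Y ℝ} :
    IsNearlyDoublyBalanced η B ↔ (∀ i j, 0 ≤ B i j) ∧ ‖defect B‖ ≤ η * size B := by
  have hm : (0 : ℝ) < Fintype.card X := Nat.cast_pos.2 Fintype.card_pos
  have hn : (0 : ℝ) < Fintype.card Y := Nat.cast_pos.2 Fintype.card_pos
  have habs : ∀ {c x : ℝ}, 0 < c → (|size B - c * x| ≤ η * size B ↔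
      (1 - η) * (size B / c) ≤ x ∧ x ≤ (1 + η) * (size B / c)) := fun hc => by
    rw [← mul_div_assoc, ← mul_div_assoc, div_le_iff₀ hc, le_div_iff₀ hc, abs_sub_le_iff]
    constructor <;> rintro ⟨h1, h2⟩ <;> constructor <;> linarith
  simp only [pi_norm_le_iff_of_nonempty, Sum.forall, defect_inl, defect_inr, Real.norm_eq_abs,
    habs hm, habs hn]
  exact ⟨fun h => ⟨h.nonneg, fun i => ⟨h.row_lower i, h.row_upper i⟩,
    fun j => ⟨h.col_lower j, h.col_upper j⟩⟩, fun ⟨h0, hr, hc⟩ =>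
      ⟨h0, fun i => (hr i).1, fun i => (hr i).2, fun j => (hc j).1, fun j => (hc j).2⟩⟩

variable {B : ℝ → Matrix X Y ℝ} {B' : Matrix X Y ℝ} {s : Set ℝ} {t : ℝ}

lemma hasDerivWithinAt_size
    (h : ∀ i j, HasDerivWithinAt (fun τ => B τ i j) (B' i j) s t) :
    HasDerivWithinAt (fun τ => size (B τ)) (size B') s t :=
  HasDerivWithinAt.fun_sum fun i _ => HasDerivWithinAt.fun_sum fun j _ => h i j

lemma hasDerivWithinAt_defect
    (h : ∀ i j, HasDerivWithinAt (fun τ => B τ i j) (B' i j) s t) (k : X ⊕ Y) :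
    HasDerivWithinAt (fun τ => defect (B τ) k) (defect B' k) s t := by
  rcases k with i | j
  · exact (hasDerivWithinAt_size h).fun_sub
      ((HasDerivWithinAt.fun_sum fun j _ => h i j).const_mul _)
  · exact (hasDerivWithinAt_size h).fun_sub
      ((HasDerivWithinAt.fun_sum fun i _ => h i j).const_mul _)

lemma hasDerivWithinAt_imbalance
    (h : ∀ i j, HasDerivWithinAt (fun τ => B τ i j) (B' i j) s t) :
    HasDerivWithinAt (fun τ => imbalance (B τ))
      (-2 * ∑ i, ∑ j, (defect (B t) (.inl i) + defect (B t) (.inr j)) * B' i j) s t := by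
  have hsq : ∀ k, HasDerivWithinAt (fun τ => defect (B τ) k ^ 2)
      (2 * (defect (B t) k * defect B' k)) s t := fun k =>
    ((hasDerivWithinAt_defect h k).fun_pow 2).congr_deriv (by push_cast; ring)
  refine (((HasDerivWithinAt.fun_sum fun i _ => hsq (.inl i)).div_const _).fun_add
    ((HasDerivWithinAt.fun_sum fun j _ => hsq (.inr j)).div_const _)).congr_deriv ?_
  rw [neg_mul, ← mul_neg, ← sum_defect_mul_defect, ← mul_sum, ← mul_sum]
  ring

end Defect

section Flow

/-- The velocity which the gradient flow induces on the scaled matrix `B`, the entrywise square of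
its state. -/
noncomputable def scalingVelocity (B : Matrix X Y ℝ) : Matrix X Y ℝ := fun i j =>
  2 * ((defect B (.inl i) + defect B (.inr j)) * B i j)

/-- `B` evolves on `[0, ∞)` like the scaled matrix of a gradient flow. Unlike `IsGradientFlow`,
this does not mention the square roots of the entries. -/
structure IsScalingFlow (B : ℝ → Matrix X Y ℝ) : Prop where
  nonneg : ∀ t, 0 ≤ t → ∀ i j, 0 ≤ B t i j
  deriv : ∀ t, 0 ≤ t → ∀ i j,
    HasDerivWithinAt (fun τ => B τ i j) (scalingVelocity (B t) i j) (Set.Ici 0) t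

lemma IsGradientFlow.isScalingFlow {B₀ : Matrix X Y ℝ} {a : ℝ → Matrix X Y ℝ}
    (ha : IsGradientFlow B₀ a) : IsScalingFlow fun t => entrySq (a t) where
  nonneg _ _ _ _ := sq_nonneg _
  deriv t ht i j := ((ha.deriv t ht i j).fun_pow 2).congr_deriv (by
    simp only [velocity, scalingVelocity, defect_inl, defect_inr, entrySq]
    push_cast
    ring)

lemma IsGradientFlow.entrySq_zero {B₀ : Matrix X Y ℝ} {a : ℝ → Matrix X Y ℝ}
    (ha : IsGradientFlow B₀ a) (hB₀ : ∀ i j, 0 ≤ B₀ i j) : entrySq (a 0) = B₀ := by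
  ext i j
  rw [entrySq, ha.init, Real.sq_sqrt (hB₀ i j)]

lemma size_scalingVelocity (B : Matrix X Y ℝ) : size (scalingVelocity B) = -2 * imbalance B := by
  simp only [size, scalingVelocity, ← mul_sum, sum_defect_add_defect_mul]
  ring

lemma mul_rowSum_scalingVelocity_nonneg {B : Matrix X Y ℝ} (hB : ∀ i j, 0 ≤ B i j) {σ : ℝ} {i : X}
    (h : ∀ j, 0 ≤ σ * (defect B (.inl i) + defect B (.inr j))) :
    0 ≤ σ * rowSum (scalingVelocity B) i := by
  rw [rowSum, mul_sum]
  refine sum_nonneg fun j _ => ?_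
  rw [scalingVelocity, mul_left_comm, ← mul_assoc σ]
  exact mul_nonneg zero_le_two (mul_nonneg (h j) (hB i j))

lemma mul_colSum_scalingVelocity_nonneg {B : Matrix X Y ℝ} (hB : ∀ i j, 0 ≤ B i j) {σ : ℝ} {j : Y}
    (h : ∀ i, 0 ≤ σ * (defect B (.inl i) + defect B (.inr j))) :
    0 ≤ σ * colSum (scalingVelocity B) j := by
  rw [colSum, mul_sum]
  refine sum_nonneg fun i _ => ?_
  rw [scalingVelocity, mul_left_comm, ← mul_assoc σ]
  exact mul_nonneg zero_le_two (mul_nonneg (h i) (hB i j))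

/-- `B` satisfies a Poincaré inequality with constant `κ`: on functions of mean zero on both sides
of the weighted bipartite graph `B`, its signless Laplacian is at least `κ` with respect to the
uniform probability measures. -/
def HasPoincareConstant (κ : ℝ) (B : Matrix X Y ℝ) : Prop :=
  ∀ (f : X → ℝ) (g : Y → ℝ), ∑ i, f i = 0 → ∑ j, g j = 0 →
    κ * ((∑ i, f i ^ 2) / Fintype.card X + (∑ j, g j ^ 2) / Fintype.card Y) ≤
      ∑ i, ∑ j, B i j * (f i + g j) ^ 2

lemma HasPoincareConstant.of_mul_le {κ c : ℝ} {B B' : Matrix X Y ℝ} (h : HasPoincareConstant κ B)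
    (hc : 0 ≤ c) (hB : ∀ i j, c * B i j ≤ B' i j) : HasPoincareConstant (c * κ) B' :=
  fun f g hf hg => by
    rw [mul_assoc]
    refine (mul_le_mul_of_nonneg_left (h f g hf hg) hc).trans ?_
    simp only [mul_sum, ← mul_assoc]
    gcongr with i _ j _
    exact hB i j

namespace IsScalingFlow

variable {B : ℝ → Matrix X Y ℝ} (hB : IsScalingFlow B)

include hB

lemma hasDerivWithinAt_size {t : ℝ} (ht : 0 ≤ t) :
    HasDerivWithinAt (fun τ => size (B τ)) (-2 * imbalance (B t)) (Set.Ici 0) t :=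
  size_scalingVelocity (B t) ▸ MatrixScaling.hasDerivWithinAt_size (hB.deriv t ht)

lemma hasDerivWithinAt_imbalance {t : ℝ} (ht : 0 ≤ t) :
    HasDerivWithinAt (fun τ => imbalance (B τ))
      (-4 * ∑ i, ∑ j, B t i j * (defect (B t) (.inl i) + defect (B t) (.inr j)) ^ 2)
      (Set.Ici 0) t := by
  refine (MatrixScaling.hasDerivWithinAt_imbalance (hB.deriv t ht)).congr_deriv ?_
  simp only [scalingVelocity, mul_sum]
  exact sum_congr rfl fun i _ => sum_congr rfl fun j _ => by ring

lemma continuousOn_defect (k : X ⊕ Y) : ContinuousOn (fun t => defect (B t) k) (Set.Ici 0) :=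
  fun t ht => (hasDerivWithinAt_defect (hB.deriv t ht) k).continuousWithinAt

lemma imbalance_le {t : ℝ} (ht : 0 ≤ t) : imbalance (B t) ≤ imbalance (B 0) :=
  le_of_hasDerivWithinAt_le (fun τ hτ => hB.hasDerivWithinAt_imbalance hτ.1)
    (fun τ _ => hasDerivWithinAt_const τ _ _) le_rfl (fun τ hτ => by
      have : 0 ≤ ∑ i, ∑ j, B τ i j * (defect (B τ) (.inl i) + defect (B τ) (.inr j)) ^ 2 :=
        sum_nonneg fun i _ => sum_nonneg fun j _ =>
          mul_nonneg (hB.nonneg τ hτ.1 i j) (sq_nonneg _)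
      linarith) ht

/- `σ u_i + s` and `-σ v_j + s`, where `u` and `v` are the defects of rows and columns, obey a
maximum principle: if `σ u_i + s` is the largest of them, then `σ (u_i + v_j) ≥ 0` for all `j`, so
that `σ r_i` does not decrease, and neither does `-s`. -/
lemma mul_defect_add_size_le {σ : ℝ} (hσ : |σ| ≤ 1) {t : ℝ} (ht : 0 ≤ t) (k : X ⊕ Y) :
    Sum.elim (fun _ => σ) (fun _ => -σ) k * defect (B t) k + size (B t) ≤
      ‖defect (B 0)‖ + size (B 0) := by
  set g : X ⊕ Y → ℝ := Sum.elim (fun _ => σ) fun _ => -σ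
  obtain ⟨hσ₁, hσ₂⟩ := abs_le.1 hσ
  refine forall_le_of_hasDerivWithinAt_nonpos_of_isMax
    (f := fun k τ => g k * defect (B τ) k + size (B τ))
    (fun k τ hτ => ((hasDerivWithinAt_defect (hB.deriv τ hτ) k).const_mul (g k)).fun_add
      (hB.hasDerivWithinAt_size hτ)) (fun k τ hτ hmax => ?_) (fun k => ?_) ht k
  · have hΔ := imbalance_nonneg (B τ)
    rcases k with i | j
    · have hrow := mul_rowSum_scalingVelocity_nonneg (hB.nonneg τ hτ) (σ := σ) (i := i) fun j => by
        have := hmax (.inr j)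
        simp only [g, Sum.elim_inl, Sum.elim_inr] at this
        linarith
      simp only [g, Sum.elim_inl, defect_inl, size_scalingVelocity]
      nlinarith [mul_nonneg (Nat.cast_nonneg (α := ℝ) (Fintype.card X)) hrow]
    · have hcol := mul_colSum_scalingVelocity_nonneg (hB.nonneg τ hτ) (σ := -σ) (j := j) fun i => by
        have := hmax (.inl i)
        simp only [g, Sum.elim_inl, Sum.elim_inr] at this
        linarith
      simp only [g, Sum.elim_inr, defect_inr, size_scalingVelocity]
      nlinarith [mul_nonneg (Nat.cast_nonneg (α := ℝ) (Fintype.card Y)) hcol]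
  · gcongr
    refine (le_abs_self _).trans ((abs_mul _ _).trans_le ?_)
    refine (mul_le_of_le_one_left (abs_nonneg _) ?_).trans (norm_le_pi_norm (defect (B 0)) k)
    rcases k with i | j <;> simpa [g]

lemma norm_defect_le {t : ℝ} (ht : 0 ≤ t) :
    ‖defect (B t)‖ ≤ ‖defect (B 0)‖ + (size (B 0) - size (B t)) := by
  have hs : size (B t) ≤ size (B 0) := le_of_hasDerivWithinAt_le
    (fun τ hτ => hB.hasDerivWithinAt_size hτ.1) (fun τ _ => hasDerivWithinAt_const τ _ _) le_rfl
    (fun τ _ => by linarith [imbalance_nonneg (B τ)]) ht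
  refine (pi_norm_le_iff_of_nonneg (by positivity [sub_nonneg.2 hs])).2 fun k => ?_
  have h₁ := hB.mul_defect_add_size_le (σ := 1) (by simp) ht k
  have h₂ := hB.mul_defect_add_size_le (σ := -1) (by simp) ht k
  rcases k with i | j <;> simp only [Sum.elim_inl, Sum.elim_inr] at h₁ h₂ <;>
    exact abs_le.2 ⟨by linarith, by linarith⟩

lemma exists_potential : ∃ p : ℝ → X ⊕ Y → ℝ, p 0 = 0 ∧
    (∀ t, 0 ≤ t → HasDerivWithinAt p (defect (B t)) (Set.Ici 0) t) ∧
    ∀ t, 0 ≤ t → ∀ i j, B t i j = B 0 i j * Real.exp (2 * (p t (.inl i) + p t (.inr j))) := by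
  obtain ⟨p, hp0, hp⟩ := exists_hasDerivWithinAt_Ici (continuousOn_pi.2 hB.continuousOn_defect)
  refine ⟨p, hp0, hp, fun t ht i j => ?_⟩
  have hconst : ∀ τ, 0 ≤ τ → HasDerivWithinAt
      (fun τ => B τ i j * Real.exp (-(2 * (p τ (.inl i) + p τ (.inr j))))) 0 (Set.Ici 0) τ :=
    fun τ hτ => ((hB.deriv τ hτ i j).mul (((hasDerivWithinAt_pi.1 (hp τ hτ) (.inl i)).fun_add
      (hasDerivWithinAt_pi.1 (hp τ hτ) (.inr j))).const_mul 2).fun_neg.exp).congr_deriv (by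
        simp only [scalingVelocity]
        ring)
  have heq := constant_of_has_deriv_right_zero
    (fun τ hτ => (hconst τ hτ.1).continuousWithinAt.mono Set.Icc_subset_Ici_self)
    (fun τ hτ => (hconst τ hτ.1).mono (Set.Ici_subset_Ici.2 hτ.1)) t (Set.right_mem_Icc.2 ht)
  simp only [hp0, Pi.zero_apply, add_zero, mul_zero, neg_zero, Real.exp_zero, mul_one] at heq
  rw [← heq, mul_assoc, ← Real.exp_add, neg_add_cancel, Real.exp_zero, mul_one]

lemma isScalingOf {t : ℝ} (ht : 0 ≤ t) : IsScalingOf (B t) (B 0) := by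
  obtain ⟨p, -, -, hBp⟩ := hB.exists_potential
  refine ⟨fun i => Real.exp (2 * p t (.inl i)), fun j => Real.exp (2 * p t (.inr j)),
    fun i => Real.exp_pos _, fun j => Real.exp_pos _, fun i j => ?_⟩
  rw [hBp t ht, mul_add, Real.exp_add]
  ring

lemma defect_eq_zero (h0 : defect (B 0) = 0) {t : ℝ} (ht : 0 ≤ t) : defect (B t) = 0 := by
  have hΔ : imbalance (B t) ≤ 0 := (hB.imbalance_le ht).trans (by simp [imbalance, h0])
  have hsq := norm_defect_sq_le (le_max_left _ _) (le_max_right _ _) (B t)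
  rw [le_antisymm hΔ (imbalance_nonneg _), mul_zero] at hsq
  exact norm_eq_zero.1 (pow_eq_zero_iff two_ne_zero |>.1 (le_antisymm hsq (sq_nonneg _)))

section Poincare

variable {κ T : ℝ} (hP : ∀ t ∈ Set.Icc 0 T, HasPoincareConstant κ (B t)) (hT : 0 ≤ T)

include hP hT

lemma imbalance_le_mul_exp : imbalance (B T) ≤ imbalance (B 0) * Real.exp (-(4 * κ * T)) :=
  le_mul_exp_of_hasDerivWithinAt_le (fun t ht => hB.hasDerivWithinAt_imbalance ht.1)
    (fun t ht => by
      have := hP t ht _ _ (sum_defect_inl (B t)) (sum_defect_inr (B t))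
      rw [← imbalance] at this
      linarith) hT

lemma imbalance_add_mul_size_le :
    imbalance (B T) + 2 * κ * (size (B 0) - size (B T)) ≤ imbalance (B 0) := by
  have hLyapunov := le_of_hasDerivWithinAt_le (g := fun _ => imbalance (B 0)) (fun t ht =>
      (hB.hasDerivWithinAt_imbalance ht.1).fun_add
        (((hB.hasDerivWithinAt_size ht.1).const_sub (size (B 0))).const_mul (2 * κ)))
    (fun t _ => hasDerivWithinAt_const t _ _) (by simp) (fun t ht => by
      have := hP t ht _ _ (sum_defect_inl (B t)) (sum_defect_inr (B t))
      rw [← imbalance] at this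
      linarith) hT
  exact hLyapunov

lemma size_sub_norm_defect_le (hκ : 0 < κ) (hδ : ‖defect (B 0)‖ ≤ κ) :
    size (B 0) - ‖defect (B 0)‖ ≤ size (B T) := by
  have hloss : κ * (size (B 0) - size (B T)) ≤ κ * ‖defect (B 0)‖ := by
    nlinarith [hB.imbalance_add_mul_size_le hP hT, MatrixScaling.imbalance_le (B 0),
      imbalance_nonneg (B T), norm_nonneg (defect (B 0))]
  linarith [le_of_mul_le_mul_left hloss hκ]

lemma norm_defect_le_mul_exp (hκ : 0 < κ) (hδ : ‖defect (B 0)‖ ≤ κ) {N : ℝ} (hN : 1 ≤ N)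
    (hX : Fintype.card X ≤ N) (hY : Fintype.card Y ≤ N) :
    ‖defect (B T)‖ ≤
      2 * ‖defect (B 0)‖ * Real.exp (1 - 2 * κ * T / (Real.log N + 1)) := by
  rw [← abs_norm (defect (B T))]
  refine abs_le_mul_exp_of_sq_le hN ?_ ?_
  · rw [abs_norm]
    linarith [hB.norm_defect_le hT, hB.size_sub_norm_defect_le hP hT hκ hδ]
  · calc ‖defect (B T)‖ ^ 2 ≤ N * imbalance (B T) := norm_defect_sq_le hX hY _
      _ ≤ N * (2 * ‖defect (B 0)‖ ^ 2 * Real.exp (-(4 * κ * T))) := by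
          have := MatrixScaling.imbalance_le (B 0)
          grw [hB.imbalance_le_mul_exp hP hT, this]
      _ ≤ N * (4 * ‖defect (B 0)‖ ^ 2 * Real.exp (-(4 * κ * T))) := by
          gcongr
          norm_num
      _ = N * (2 * ‖defect (B 0)‖ * Real.exp (-(2 * κ * T))) ^ 2 := by
          rw [mul_pow, mul_pow, ← Real.exp_nat_mul]
          push_cast
          ring_nf

end Poincare

/- The potentials whose exponentials scale `B 0` to `B t` move at the speed of the defect, which
decays; so they stay small, the entries of `B t` stay comparable to those of `B 0`, and the
Poincaré inequality which causes the decay survives. -/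
lemma half_le_of_hasPoincareConstant {κ : ℝ} (hκ : 0 < κ) (hP : HasPoincareConstant κ (B 0))
    {N : ℝ} (hN : 1 ≤ N) (hX : Fintype.card X ≤ N) (hY : Fintype.card Y ≤ N)
    (hδ : 48 * (‖defect (B 0)‖ * (Real.log N + 1)) ≤ κ) {t : ℝ} (ht : 0 ≤ t) (i : X) (j : Y) :
    1 / 2 * B 0 i j ≤ B t i j := by
  obtain ⟨p, hp0, hp, hBp⟩ := hB.exists_potential
  have hL : 1 ≤ Real.log N + 1 := by linarith [Real.log_nonneg hN]
  have hδ0 : ‖defect (B 0)‖ ≤ κ / 2 := by nlinarith [norm_nonneg (defect (B 0))]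
  have hhalf : ∀ t, 0 ≤ t → ‖p t‖ ≤ 1 / 8 → ∀ i j, 1 / 2 * B 0 i j ≤ B t i j :=
    fun t ht hpt i j => by
      rw [hBp t ht, mul_comm]
      gcongr
      · exact hB.nonneg 0 le_rfl i j
      · have hi := (abs_le.1 ((norm_le_pi_norm (p t) (.inl i)).trans hpt)).1
        have hj := (abs_le.1 ((norm_le_pi_norm (p t) (.inr j)).trans hpt)).1
        linarith [Real.add_one_le_exp (2 * (p t (.inl i) + p t (.inr j)))]
  refine hhalf t ht (forall_lt_of_bootstrap (f := fun t => ‖p t‖)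
    (fun t ht => (hp t ht).continuousWithinAt.norm) (by simp [hp0])
    (fun T hT hsmall => ?_) ht).le i j
  have hdefect : ∀ t ∈ Set.Icc 0 T, ‖defect (B t)‖ ≤
      2 * ‖defect (B 0)‖ * Real.exp 1 * Real.exp (-(κ / (Real.log N + 1) * t)) := fun t ht => by
    refine (hB.norm_defect_le_mul_exp (κ := 1 / 2 * κ) (fun τ hτ => hP.of_mul_le (by norm_num)
      (hhalf τ hτ.1 (hsmall τ ⟨hτ.1, hτ.2.trans ht.2⟩))) ht.1 (by linarith) (by linarith) hN hX
      hY).trans_eq ?_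
    rw [mul_assoc _ (Real.exp 1), ← Real.exp_add]
    ring_nf
  refine (norm_le_div_of_norm_deriv_le_mul_exp (by positivity) (by positivity) hp0
    (fun t ht => hp t ht.1) hdefect hT).trans_lt ?_
  rw [div_div_eq_mul_div, div_lt_iff₀ hκ]
  nlinarith [Real.exp_one_lt_d9,
    mul_nonneg (norm_nonneg (defect (B 0))) (zero_le_one.trans hL)]

theorem norm_defect_le_mul_exp_of_hasPoincareConstant {κ : ℝ} (hκ : 0 < κ)
    (hP : HasPoincareConstant κ (B 0)) {N : ℝ} (hN : 1 ≤ N) (hX : Fintype.card X ≤ N)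
    (hY : Fintype.card Y ≤ N) (hδ : 48 * (‖defect (B 0)‖ * (Real.log N + 1)) ≤ κ) {t : ℝ}
    (ht : 0 ≤ t) : size (B 0) - ‖defect (B 0)‖ ≤ size (B t) ∧
      ‖defect (B t)‖ ≤ 2 * ‖defect (B 0)‖ * Real.exp (1 - κ * t / (Real.log N + 1)) := by
  have hPt : ∀ τ ∈ Set.Icc 0 t, HasPoincareConstant (1 / 2 * κ) (B τ) := fun τ hτ =>
    hP.of_mul_le (by norm_num) (hB.half_le_of_hasPoincareConstant hκ hP hN hX hY hδ hτ.1)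
  have hδ0 : ‖defect (B 0)‖ ≤ 1 / 2 * κ := by
    nlinarith [norm_nonneg (defect (B 0)), Real.log_nonneg hN]
  refine ⟨hB.size_sub_norm_defect_le hPt ht (by positivity) hδ0, ?_⟩
  have := hB.norm_defect_le_mul_exp hPt ht (by positivity) hδ0 hN hX hY
  rwa [← mul_assoc 2, mul_one_div_cancel two_ne_zero, one_mul] at this

end IsScalingFlow

end Flow

section Existence

open scoped Manifold InnerProductSpace

theorem exists_forall_hasDerivAt_of_hasCompactSupport {E : Type*} [NormedAddCommGroup E]
    [NormedSpace ℝ E] [CompleteSpace E] {v : E → E} (hv : ContDiff ℝ 1 v)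
    (hsupp : HasCompactSupport v) (x : E) :
    ∃ γ : ℝ → E, γ 0 = x ∧ ∀ t, HasDerivAt γ (v (γ t)) t := by
  obtain ⟨K, hK⟩ := hv.lipschitzWith_of_hasCompactSupport hsupp one_ne_zero
  obtain ⟨L, hL⟩ := hsupp.exists_bound_of_continuous hv.continuous
  have hlocal : ∀ a, ∃ γ : ℝ → E, γ 0 = x ∧
      IsMIntegralCurveOn (I := 𝓘(ℝ, E)) γ v (Set.Ioo (-a) a) := fun a => by
    have hPL : IsPicardLindelof (fun _ => v) (tmin := -|a|) (tmax := |a|) ⟨0, by simp⟩ x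
        (L.toNNReal * |a|.toNNReal) 0 L.toNNReal K :=
      IsPicardLindelof.of_time_independent (fun x _ => (hL x).trans (Real.le_coe_toNNReal L))
        hK.lipschitzOnWith (by simp)
    obtain ⟨γ, hγ0, hγ⟩ := hPL.exists_eq_forall_mem_Icc_hasDerivWithinAt₀
    have hsub : Set.Ioo (-a) a ⊆ Set.Icc (-|a|) |a| := fun t ht =>
      ⟨(neg_le_neg (le_abs_self a)).trans ht.1.le, ht.2.le.trans (le_abs_self a)⟩
    refine ⟨γ, hγ0, fun t ht => ?_⟩
    have hder := ((hγ t (hsub ht)).mono hsub).hasFDerivWithinAt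
    exact hasMFDerivWithinAt_iff_hasFDerivWithinAt.2 hder
  obtain ⟨γ, hγ0, hγ⟩ := (exists_isMIntegralCurve_iff_exists_isMIntegralCurveOn_Ioo
    (contMDiff_vectorSpace_iff_contDiff.2 hv) x).2 hlocal
  refine ⟨γ, hγ0, fun t => ?_⟩
  have hder : HasFDerivAt γ ((1 : ℝ →L[ℝ] ℝ).smulRight (v (γ t))) t := (hγ t).hasFDerivAt
  simpa using hder.hasDerivAt

/- Cut off outside a ball, `v` has a global integral curve; the integral curve never leaves the
ball, as its norm is non-increasing. -/
theorem exists_forall_hasDerivAt_of_inner_nonpos {E : Type*} [NormedAddCommGroup E]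
    [InnerProductSpace ℝ E] [FiniteDimensional ℝ E] {v : E → E} (hv : ContDiff ℝ 1 v)
    (hinner : ∀ x, ⟪x, v x⟫_ℝ ≤ 0) (x : E) :
    ∃ γ : ℝ → E, γ 0 = x ∧ ∀ t, 0 ≤ t → HasDerivAt γ (v (γ t)) t := by
  let χ : ContDiffBump (0 : E) := ⟨‖x‖ + 1, ‖x‖ + 2, by positivity, by linarith⟩
  obtain ⟨γ, hγ0, hγ⟩ := exists_forall_hasDerivAt_of_hasCompactSupport
    (χ.contDiff.smul hv) χ.hasCompactSupport.smul_right x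
  have hnorm : ∀ t, 0 ≤ t → ‖γ t‖ ^ 2 ≤ ‖x‖ ^ 2 := fun t ht => by
    rw [← hγ0]
    refine le_of_hasDerivWithinAt_le (fun t _ => (hγ t).norm_sq.hasDerivWithinAt)
      (fun t _ => hasDerivWithinAt_const t _ _) le_rfl (fun t _ => ?_) ht
    rw [Pi.smul_apply', real_inner_smul_right]
    nlinarith [hinner (γ t), χ.nonneg (x := γ t)]
  refine ⟨γ, hγ0, fun t ht => ?_⟩
  have hball : γ t ∈ Metric.closedBall 0 χ.rIn := mem_closedBall_zero_iff.2
    ((pow_le_pow_iff_left₀ (norm_nonneg _) (norm_nonneg _) two_ne_zero |>.1 (hnorm t ht)).trans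
      (le_add_of_nonneg_right zero_le_one))
  simpa [χ.one_of_mem_closedBall hball] using hγ t

lemma sum_mul_velocity (a : Matrix X Y ℝ) :
    ∑ i, ∑ j, a i j * velocity a i j = -imbalance (entrySq a) := by
  rw [← sum_defect_add_defect_mul]
  refine sum_congr rfl fun i _ => sum_congr rfl fun j _ => ?_
  simp only [velocity, entrySq, defect_inl, defect_inr]
  ring

theorem exists_isGradientFlow (B₀ : Matrix X Y ℝ) : ∃ a, IsGradientFlow B₀ a := by
  let v : EuclideanSpace ℝ (X × Y) → EuclideanSpace ℝ (X × Y) := fun a =>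
    WithLp.toLp 2 fun k => velocity (fun i j => a (i, j)) k.1 k.2
  have hv : ContDiff ℝ 1 v := contDiff_euclidean.2 fun k => by
    simp only [v, velocity, size, rowSum, colSum, entrySq]
    fun_prop
  have hinner : ∀ a, ⟪a, v a⟫_ℝ ≤ 0 := fun a => by
    have := sum_mul_velocity fun i j => a (i, j)
    simp only [PiLp.inner_apply, Fintype.sum_prod_type]
    simp only [v, RCLike.inner_apply, conj_trivial, mul_comm]
    exact this.trans_le (neg_nonpos.2 (imbalance_nonneg _))
  obtain ⟨γ, hγ0, hγ⟩ := exists_forall_hasDerivAt_of_inner_nonpos hv hinner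
    (WithLp.toLp 2 fun k => Real.sqrt (B₀ k.1 k.2))
  refine ⟨fun t i j => γ t (i, j), fun i j => by simp [hγ0], fun t ht i j => ?_⟩
  have hder := hasFDerivWithinAt_euclidean.1
    ((hγ t ht).hasDerivWithinAt (s := Set.Ici 0)).hasFDerivWithinAt (i, j)
  exact hder.hasDerivWithinAt.congr_deriv (by simp [v])

end Existence

section Bipartite

/-- The symmetric edge weights on `X ⊕ Y` of the bipartite graph in which `i` and `j` are joined
by an edge of weight `B i j`. -/
def bipartiteWeight {X Y : Type*} (B : Matrix X Y ℝ) : X ⊕ Y → X ⊕ Y → ℝ :=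
  Matrix.fromBlocks 0 B B.transpose 0

lemma bipartiteWeight_nonneg {X Y : Type*} {B : Matrix X Y ℝ} (hB : ∀ i j, 0 ≤ B i j) :
    ∀ x y, 0 ≤ bipartiteWeight B x y := by
  rintro (i | j) (i' | j') <;> simp [bipartiteWeight, hB]

lemma bipartiteWeight_comm {X Y : Type*} (B : Matrix X Y ℝ) :
    ∀ x y, bipartiteWeight B x y = bipartiteWeight B y x := by
  rintro (i | j) (i' | j') <;> simp [bipartiteWeight]

lemma bipartiteWeight_smul {X Y : Type*} (c : ℝ) (B : Matrix X Y ℝ) :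
    bipartiteWeight (c • B) = c • bipartiteWeight B := by
  ext x y
  rw [Pi.smul_apply, Pi.smul_apply]
  rcases x with i | j <;> rcases y with i' | j' <;> simp [bipartiteWeight]

lemma sum_bipartiteWeight_inl (B : Matrix X Y ℝ) (i : X) :
    ∑ y, bipartiteWeight B (.inl i) y = rowSum B i := by
  simp [bipartiteWeight, rowSum]

lemma sum_bipartiteWeight_inr (B : Matrix X Y ℝ) (j : Y) :
    ∑ y, bipartiteWeight B (.inr j) y = colSum B j := by
  simp [bipartiteWeight, colSum]

lemma sum_bipartiteWeight_mul (B : Matrix X Y ℝ) {F : X ⊕ Y → X ⊕ Y → ℝ}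
    (hF : ∀ x y, F x y = F y x) : ∑ x, ∑ y, bipartiteWeight B x y * F x y =
      2 * ∑ i, ∑ j, B i j * F (.inl i) (.inr j) := by
  simp only [bipartiteWeight, Fintype.sum_sum_type, Matrix.fromBlocks_apply₁₁,
    Matrix.fromBlocks_apply₁₂, Matrix.fromBlocks_apply₂₁, Matrix.fromBlocks_apply₂₂,
    Matrix.zero_apply, Matrix.transpose_apply, zero_mul, sum_const_zero, zero_add, add_zero,
    hF (.inr _) (.inl _)]
  rw [sum_comm (s := (univ : Finset Y)), two_mul]

/- Cheeger's inequality for the function which is `f` on `X` and `-g` on `Y`. -/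
lemma IsNearlyDoublyBalanced.hasPoincareConstant [DecidableEq X] [DecidableEq Y] {ε : ℝ}
    {B : Matrix X Y ℝ} (hB : IsNearlyDoublyBalanced ε B) (hε : ε ≤ 1) :
    HasPoincareConstant (conductance (bipartiteWeight B) ^ 2 * ((1 - ε) * size B) / 2) B := by
  intro f g hf hg
  have hs : 0 ≤ size B := sum_nonneg fun i _ => sum_nonneg fun j _ => hB.nonneg i j
  have h := conductance_sq_mul_sum_sq_le (bipartiteWeight_nonneg hB.nonneg)
    (bipartiteWeight_comm B)
    (π := Sum.elim (fun _ => (1 - ε) * (size B / Fintype.card X))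
      fun _ => (1 - ε) * (size B / Fintype.card Y))
    (by rintro (i | j) <;> simp only [Sum.elim_inl, Sum.elim_inr] <;>
      positivity [sub_nonneg.2 hε])
    (by
      rintro (i | j)
      · exact (hB.row_lower i).trans_eq (sum_bipartiteWeight_inl B i).symm
      · exact (hB.col_lower j).trans_eq (sum_bipartiteWeight_inr B j).symm)
    (f := Sum.elim f fun j => -g j)
    (by simp [← mul_sum, hf, hg])
  rw [sum_bipartiteWeight_mul B fun x y => by ring] at h
  simp only [Fintype.sum_sum_type, Sum.elim_inl, Sum.elim_inr, ← mul_sum, neg_sq,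
    sub_neg_eq_add] at h
  exact le_of_mul_le_mul_left (Eq.trans_le (by ring) h) two_pos

lemma size_smul (c : ℝ) (B : Matrix X Y ℝ) : size (c • B) = c * size B := by
  simp only [size, Matrix.smul_apply, smul_eq_mul, mul_sum]

lemma rowSum_smul {X : Type*} (c : ℝ) (B : Matrix X Y ℝ) (i : X) :
    rowSum (c • B) i = c * rowSum B i := by
  simp only [rowSum, Matrix.smul_apply, smul_eq_mul, mul_sum]

lemma colSum_smul {Y : Type*} (c : ℝ) (B : Matrix X Y ℝ) (j : Y) :
    colSum (c • B) j = c * colSum B j := by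
  simp only [colSum, Matrix.smul_apply, smul_eq_mul, mul_sum]

lemma IsNearlyDoublyBalanced.smul {η c : ℝ} {B : Matrix X Y ℝ} (hB : IsNearlyDoublyBalanced η B)
    (hc : 0 ≤ c) : IsNearlyDoublyBalanced η (c • B) where
  nonneg i j := mul_nonneg hc (hB.nonneg i j)
  row_lower i := by
    rw [size_smul, rowSum_smul, mul_div_assoc, mul_left_comm]
    exact mul_le_mul_of_nonneg_left (hB.row_lower i) hc
  row_upper i := by
    rw [size_smul, rowSum_smul, mul_div_assoc, mul_left_comm]
    exact mul_le_mul_of_nonneg_left (hB.row_upper i) hc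
  col_lower j := by
    rw [size_smul, colSum_smul, mul_div_assoc, mul_left_comm]
    exact mul_le_mul_of_nonneg_left (hB.col_lower j) hc
  col_upper j := by
    rw [size_smul, colSum_smul, mul_div_assoc, mul_left_comm]
    exact mul_le_mul_of_nonneg_left (hB.col_upper j) hc

lemma IsScalingOf.of_smul {X Y : Type*} {c : ℝ} (hc : 0 < c) {B A : Matrix X Y ℝ}
    (h : IsScalingOf B (c • A)) : IsScalingOf B A := by
  obtain ⟨l, r, hl, hr, h⟩ := h
  refine ⟨fun i => l i * c, r, fun i => mul_pos (hl i) hc, hr, fun i j => ?_⟩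
  rw [h, Matrix.smul_apply, smul_eq_mul, ← mul_assoc (l i)]

lemma IsScalingOf.eq_zero {X Y : Type*} {B A : Matrix X Y ℝ} (h : IsScalingOf B A) {i : X} {j : Y}
    (hA : A i j = 0) : B i j = 0 := by
  obtain ⟨l, r, -, -, h⟩ := h
  rw [h, hA, mul_zero, zero_mul]

lemma size_pos_iff {B : Matrix X Y ℝ} (hB : ∀ i j, 0 ≤ B i j) :
    0 < size B ↔ ∃ i j, 0 < B i j := by
  simp only [size, sum_pos_iff_of_nonneg fun i _ => sum_nonneg fun j _ => hB i j,
    sum_pos_iff_of_nonneg fun j _ => hB _ j, mem_univ, true_and]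

lemma IsScalingOf.size_pos {B A : Matrix X Y ℝ} (h : IsScalingOf B A) (hA : ∀ i j, 0 ≤ A i j)
    (hs : 0 < size A) : 0 < size B := by
  obtain ⟨l, r, hl, hr, h⟩ := h
  obtain ⟨i, j, hij⟩ := (size_pos_iff hA).1 hs
  have hB : ∀ i j, 0 ≤ B i j := fun i j =>
    (mul_nonneg (mul_nonneg (hl i).le (hA i j)) (hr j).le).trans_eq (h i j).symm
  exact (size_pos_iff hB).2 ⟨i, j, (mul_pos (mul_pos (hl i) hij) (hr j)).trans_eq (h i j).symm⟩

end Bipartite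

section Graph

lemma biadjacency_nonneg {X Y : Type*} (G : SimpleGraph (X ⊕ Y)) [DecidableRel G.Adj]
    (i : X) (j : Y) : 0 ≤ biadjacency G i j := by
  unfold biadjacency
  split_ifs <;> simp

lemma adjMatrix_eq_bipartiteWeight {X Y : Type*} {G : SimpleGraph (X ⊕ Y)} [DecidableRel G.Adj]
    (hG : G ≤ completeBipartiteGraph X Y) :
    G.adjMatrix ℝ = bipartiteWeight (biadjacency G) := by
  have hX : ∀ i i', ¬G.Adj (.inl i) (.inl i') := fun i i' h => by simpa using hG h
  have hY : ∀ j j', ¬G.Adj (.inr j) (.inr j') := fun j j' h => by simpa using hG h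
  ext (i | j) (i' | j') <;> simp [bipartiteWeight, biadjacency, hX, hY, G.adj_comm (.inr _)]

lemma sum_adjMatrix_apply {V : Type*} [Fintype V] (G : SimpleGraph V) [DecidableRel G.Adj] (v : V) :
    ∑ u, G.adjMatrix ℝ v u = G.degree v := by
  simp [← SimpleGraph.card_neighborFinset_eq_degree, SimpleGraph.neighborFinset_eq_filter]

variable {G : SimpleGraph (X ⊕ Y)} [DecidableRel G.Adj]

lemma rowSum_biadjacency (hG : G ≤ completeBipartiteGraph X Y) (i : X) :
    rowSum (biadjacency G) i = G.degree (.inl i) := by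
  rw [← sum_bipartiteWeight_inl, ← adjMatrix_eq_bipartiteWeight hG]
  exact sum_adjMatrix_apply G _

lemma colSum_biadjacency (hG : G ≤ completeBipartiteGraph X Y) (j : Y) :
    colSum (biadjacency G) j = G.degree (.inr j) := by
  rw [← sum_bipartiteWeight_inr, ← adjMatrix_eq_bipartiteWeight hG]
  exact sum_adjMatrix_apply G _

lemma size_biadjacency (hG : G ≤ completeBipartiteGraph X Y) :
    size (biadjacency G) = #G.edgeFinset := by
  have hhand : ∑ v, (G.degree v : ℝ) = 2 * #G.edgeFinset := by
    exact_mod_cast G.sum_degrees_eq_twice_card_edges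
  simp only [Fintype.sum_sum_type, ← rowSum_biadjacency hG, ← colSum_biadjacency hG, sum_rowSum,
    sum_colSum] at hhand
  linarith

lemma isNearlyDoublyBalanced_biadjacency (hG : G ≤ completeBipartiteGraph X Y)
    (hXY : Fintype.card X = Fintype.card Y) {ε : ℝ}
    (hdeg : ∀ v, (1 - ε) * ((#G.edgeFinset : ℝ) / Fintype.card X) ≤ G.degree v ∧
      (G.degree v : ℝ) ≤ (1 + ε) * ((#G.edgeFinset : ℝ) / Fintype.card X)) :
    IsNearlyDoublyBalanced ε (biadjacency G) := by
  rw [← size_biadjacency hG] at hdeg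
  refine ⟨biadjacency_nonneg G, fun i => ?_, fun i => ?_, fun j => ?_, fun j => ?_⟩
  · exact (hdeg _).1.trans_eq (rowSum_biadjacency hG i).symm
  · exact (rowSum_biadjacency hG i).trans_le (hdeg _).2
  · exact hXY ▸ (hdeg _).1.trans_eq (colSum_biadjacency hG j).symm
  · exact hXY ▸ (colSum_biadjacency hG j).trans_le (hdeg _).2

end Graph

lemma IsNearlyDoublyBalanced.isNearlyPerfectFractionalMatching [Nonempty X]
    {G : SimpleGraph (X ⊕ Y)} {B : Matrix X Y ℝ} {η : ℝ}
    (hB : IsNearlyDoublyBalanced η B) (hXY : Fintype.card X = Fintype.card Y)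
    (hs : 0 < size B) (hG : ∀ i j, ¬G.Adj (.inl i) (.inr j) → B i j = 0) :
    IsNearlyPerfectFractionalMatching G η (((Fintype.card X : ℝ) / size B) • B) := by
  have hm : (0 : ℝ) < Fintype.card X := Nat.cast_pos.2 Fintype.card_pos
  have hc : 0 < Fintype.card X / size B := div_pos hm hs
  have hunit : size ((Fintype.card X / size B) • B) / Fintype.card X = 1 := by
    rw [size_smul]
    field_simp
  obtain ⟨h0, hrl, hru, hcl, hcu⟩ := hB.smul hc.le
  simp only [← hXY, hunit, mul_one] at hrl hru hcl hcu
  refine ⟨h0, fun i j h => ?_, fun i => ?_, fun j => ?_⟩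
  · rw [Matrix.smul_apply, hG i j h, smul_zero]
  · exact abs_sub_le_iff.2 ⟨by linarith [hru i], by linarith [hrl i]⟩
  · exact abs_sub_le_iff.2 ⟨by linarith [hcu j], by linarith [hcl j]⟩

section Time

lemma two_le_of_defect_ne_zero {N : ℝ} (hX : Fintype.card X ≤ N) (hY : Fintype.card Y ≤ N)
    {B : Matrix X Y ℝ} (hB : defect B ≠ 0) : 2 ≤ N := by
  contrapose! hB
  have hone : ∀ {n : ℕ}, n ≤ N → n ≤ 1 := fun hn =>
    Nat.lt_succ_iff.1 (Nat.cast_lt.1 (hn.trans_lt (by exact_mod_cast hB)))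
  have := Fintype.card_le_one_iff_subsingleton.1 (hone hX)
  have := Fintype.card_le_one_iff_subsingleton.1 (hone hY)
  ext (i | j)
  · exact (Fintype.sum_subsingleton _ i).symm.trans (sum_defect_inl B)
  · exact (Fintype.sum_subsingleton _ j).symm.trans (sum_defect_inr B)

variable [Nonempty X] [Nonempty Y] {B : ℝ → Matrix X Y ℝ} (hB : IsScalingFlow B)
  {N η t : ℝ} (hX : Fintype.card X ≤ N) (hY : Fintype.card Y ≤ N) (hη : 0 < η) (ht : 0 ≤ t)

include hB hX hY hη ht

lemma IsScalingFlow.isNearlyDoublyBalanced_of_hasPoincareConstant {κ : ℝ} (hκ : 0 < κ)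
    (hP : HasPoincareConstant κ (B 0)) (hδκ : 48 * (‖defect (B 0)‖ * (Real.log N + 1)) ≤ κ)
    (hδs : 7 * ‖defect (B 0)‖ ≤ size (B 0))
    (hlog : Real.log (1 / η) * (Real.log N + 1) ≤ κ * t) : IsNearlyDoublyBalanced η (B t) := by
  have hN : 1 ≤ N := (Nat.one_le_cast.2 Fintype.card_pos).trans hX
  have hL : 0 < Real.log N + 1 := by linarith [Real.log_nonneg hN]
  obtain ⟨hsize, hdefect⟩ := hB.norm_defect_le_mul_exp_of_hasPoincareConstant hκ hP hN hX hY hδκ ht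
  refine isNearlyDoublyBalanced_iff.2 ⟨hB.nonneg t ht, hdefect.trans ?_⟩
  have hexp : Real.exp (1 - κ * t / (Real.log N + 1)) ≤ 3 * η := by
    rw [← le_div_iff₀ hL, one_div, Real.log_inv] at hlog
    calc Real.exp (1 - κ * t / (Real.log N + 1)) ≤ Real.exp (1 + Real.log η) :=
          Real.exp_le_exp.2 (by linarith)
      _ = Real.exp 1 * η := by rw [Real.exp_add, Real.exp_log hη]
      _ ≤ 3 * η := by gcongr; exact Real.exp_one_lt_three.le
  calc 2 * ‖defect (B 0)‖ * Real.exp (1 - κ * t / (Real.log N + 1))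
      ≤ 2 * ‖defect (B 0)‖ * (3 * η) := by gcongr
    _ = η * (7 * ‖defect (B 0)‖ - ‖defect (B 0)‖) := by ring
    _ ≤ η * size (B t) := by gcongr; linarith

theorem IsScalingFlow.isNearlyDoublyBalanced_of_conductance [DecidableEq X] [DecidableEq Y]
    {ε : ℝ} (hbal : IsNearlyDoublyBalanced ε (B 0)) (hs : 0 < size (B 0))
    (hφ : 500 * ε * Real.log N ≤ conductance (bipartiteWeight (B 0)) ^ 2)
    (hlog : 10 * Real.log N * Real.log (1 / η) ≤
      size (B 0) * conductance (bipartiteWeight (B 0)) ^ 2 * t) :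
    IsNearlyDoublyBalanced η (B t) := by
  by_cases hδ : defect (B 0) = 0
  · refine isNearlyDoublyBalanced_iff.2 ⟨hB.nonneg t ht, ?_⟩
    rw [hB.defect_eq_zero hδ ht, norm_zero]
    exact mul_nonneg hη.le (sum_nonneg fun i _ => sum_nonneg fun j _ => hB.nonneg t ht i j)
  have hδε := (isNearlyDoublyBalanced_iff.1 hbal).2
  have hε : 0 < ε := pos_of_mul_pos_left ((norm_pos_iff.2 hδ).trans_le hδε) hs.le
  have hN : 0.69 ≤ Real.log N := by
    have := Real.log_le_log two_pos (two_le_of_defect_ne_zero hX hY hδ)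
    linarith [Real.log_two_gt_d9]
  have hφ1 : conductance (bipartiteWeight (B 0)) ^ 2 ≤ 1 :=
    pow_le_one₀ (conductance_nonneg (bipartiteWeight_nonneg hbal.nonneg))
      (conductance_le_one (bipartiteWeight_nonneg hbal.nonneg))
  set s := size (B 0)
  set ψ := conductance (bipartiteWeight (B 0)) ^ 2
  have hεN : ε * (Real.log N + 1) ≤ ψ / 200 := by nlinarith
  have hψ : 0 < ψ := by nlinarith
  have hε1 : ε ≤ 1 / 200 := by nlinarith
  have hκ : 2 / 5 * (ψ * s) ≤ ψ * ((1 - ε) * s) / 2 := by nlinarith [mul_pos hψ hs]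
  refine hB.isNearlyDoublyBalanced_of_hasPoincareConstant hX hY hη ht
    (lt_of_lt_of_le (by positivity) hκ) (hbal.hasPoincareConstant (by linarith)) ?_ ?_ ?_
  · calc 48 * (‖defect (B 0)‖ * (Real.log N + 1)) ≤ 48 * (ε * s * (Real.log N + 1)) := by gcongr
      _ = 48 * (ε * (Real.log N + 1)) * s := by ring
      _ ≤ 48 * (ψ / 200) * s := by gcongr
      _ ≤ ψ * ((1 - ε) * s) / 2 := by linarith [mul_pos hψ hs]
  · nlinarith
  · rcases le_total (Real.log (1 / η)) 0 with hη1 | hη1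
    · exact (mul_nonpos_of_nonpos_of_nonneg hη1 (by linarith)).trans
        (mul_nonneg (le_trans (by positivity) hκ) ht)
    · calc Real.log (1 / η) * (Real.log N + 1) ≤ Real.log (1 / η) * (4 * Real.log N) := by
            gcongr; linarith
        _ ≤ 2 / 5 * (ψ * s) * t := by linarith
        _ ≤ ψ * ((1 - ε) * s) / 2 * t := by gcongr

end Time

end MatrixScaling

open Finset MatrixScaling in
theorem corollaryc_general (X Y : Type*) [Fintype X] [Fintype Y] [DecidableEq X] [DecidableEq Y]
    (G : SimpleGraph (X ⊕ Y)) [DecidableRel G.Adj] (ε : ℝ) (hG : G ≤ completeBipartiteGraph X Y)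
    (hXY : Fintype.card X = Fintype.card Y) (hE : G.edgeFinset.Nonempty)
    (hdeg : ∀ v, (1 - ε) * ((#G.edgeFinset : ℝ) / Fintype.card X) ≤ G.degree v ∧
      (G.degree v : ℝ) ≤ (1 + ε) * ((#G.edgeFinset : ℝ) / Fintype.card X))
    (hφ : 500 * ε * Real.log (Fintype.card X) ≤ conductance (G.adjMatrix ℝ) ^ 2)
    (s₀ : ℝ) (hs₀ : 0 < s₀) :
    (∃ a, IsGradientFlow ((s₀ / #G.edgeFinset) • biadjacency G) a) ∧
      ∀ a, IsGradientFlow ((s₀ / #G.edgeFinset) • biadjacency G) a →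
        ∀ η : ℝ, 0 < η → ∀ t : ℝ, 0 ≤ t →
          10 * Real.log (Fintype.card X) * Real.log (1 / η) ≤
            s₀ * conductance (G.adjMatrix ℝ) ^ 2 * t →
          IsScalingOf (entrySq (a t)) (biadjacency G) ∧
            IsNearlyDoublyBalanced η (entrySq (a t)) ∧
            IsNearlyPerfectFractionalMatching G η
              (((Fintype.card X : ℝ) / size (entrySq (a t))) • entrySq (a t)) := by
  refine ⟨exists_isGradientFlow _, fun a ha η hη t ht hlog => ?_⟩
  have hE₀ : (0 : ℝ) < #G.edgeFinset := Nat.cast_pos.2 hE.card_pos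
  have hc : 0 < s₀ / #G.edgeFinset := div_pos hs₀ hE₀
  have hA : 0 < size (biadjacency G) := (size_biadjacency hG).symm ▸ hE₀
  obtain ⟨i, j, -⟩ := (size_pos_iff (biadjacency_nonneg G)).1 hA
  have : Nonempty X := ⟨i⟩
  have : Nonempty Y := ⟨j⟩
  have hbal₀ := (isNearlyDoublyBalanced_biadjacency hG hXY hdeg).smul hc.le
  have hinit := ha.entrySq_zero hbal₀.nonneg
  have hsize : size (entrySq (a 0)) = s₀ := by
    rw [hinit, size_smul, size_biadjacency hG, div_mul_cancel₀ _ hE₀.ne']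
  have hcond : conductance (bipartiteWeight (entrySq (a 0))) = conductance (G.adjMatrix ℝ) := by
    rw [hinit, bipartiteWeight_smul, conductance_smul hc, adjMatrix_eq_bipartiteWeight hG]
  have hflow := ha.isScalingFlow
  have hscal : IsScalingOf (entrySq (a t)) (biadjacency G) :=
    (hinit ▸ hflow.isScalingOf ht).of_smul hc
  have hbal : IsNearlyDoublyBalanced η (entrySq (a t)) :=
    hflow.isNearlyDoublyBalanced_of_conductance le_rfl (by rw [hXY]) hη ht (hinit ▸ hbal₀)
      (hsize ▸ hs₀) (by rwa [hcond]) (by rwa [hcond, hsize])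
  exact ⟨hscal, hbal, hbal.isNearlyPerfectFractionalMatching hXY
    (hscal.size_pos (biadjacency_nonneg G) hA) fun i j hij => hscal.eq_zero (if_neg hij)⟩

theorem corollaryc :
    ∃ C : ℝ, 0 < C ∧ ∃ K : ℝ, 0 < K ∧
      ∀ (X Y : Type*) [Fintype X] [Fintype Y] [DecidableEq X] [DecidableEq Y]
        (G : SimpleGraph (X ⊕ Y)) [DecidableRel G.Adj] (ε : ℝ),
        G ≤ completeBipartiteGraph X Y →
        Fintype.card X = Fintype.card Y →
        G.edgeFinset.Nonempty →
        (∀ v, (1 - ε) * ((G.edgeFinset.card : ℝ) / Fintype.card X) ≤ G.degree v ∧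
          (G.degree v : ℝ) ≤ (1 + ε) * ((G.edgeFinset.card : ℝ) / Fintype.card X)) →
        C * ε * Real.log (Fintype.card X) ≤ MatrixScaling.conductance (G.adjMatrix ℝ) ^ 4 →
        ∀ s₀ : ℝ, 0 < s₀ →
          (∃ a : ℝ → Matrix X Y ℝ, MatrixScaling.IsGradientFlow
            ((s₀ / G.edgeFinset.card) • MatrixScaling.biadjacency G) a) ∧
          ∀ a : ℝ → Matrix X Y ℝ,
            MatrixScaling.IsGradientFlow
              ((s₀ / G.edgeFinset.card) • MatrixScaling.biadjacency G) a →
            ∀ η : ℝ, 0 < η → η ≤ 1 → ∀ t : ℝ, 0 ≤ t →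
              K * Real.log (Fintype.card X) * Real.log (1 / η) ≤
                s₀ * MatrixScaling.conductance (G.adjMatrix ℝ) ^ 2 * t →
              MatrixScaling.IsScalingOf (MatrixScaling.entrySq (a t))
                  (MatrixScaling.biadjacency G) ∧
                MatrixScaling.IsNearlyDoublyBalanced η (MatrixScaling.entrySq (a t)) ∧
                MatrixScaling.IsNearlyPerfectFractionalMatching G η
                  (((Fintype.card X : ℝ) / MatrixScaling.size (MatrixScaling.entrySq (a t))) •
                    MatrixScaling.entrySq (a t)) := by
  refine ⟨500, by norm_num, 10, by norm_num, fun X Y _ _ _ _ G _ ε hG hXY hE hdeg hφ s₀ hs₀ => ?_⟩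
  have hw : ∀ x y, 0 ≤ G.adjMatrix ℝ x y := by simp [SimpleGraph.adjMatrix_apply, ite_nonneg]
  have hφ' := hφ.trans (pow_le_pow_of_le_one (MatrixScaling.conductance_nonneg hw)
    (MatrixScaling.conductance_le_one hw) (by norm_num : 2 ≤ 4))
  obtain ⟨hex, hall⟩ := corollaryc_general X Y G ε hG hXY hE hdeg hφ' s₀ hs₀
  exact ⟨hex, fun a ha η hη _ => hall a ha η hη⟩
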